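/- **Setting.** Let $p\ge 9$ be an integer, $\mathcal Z$ a measurable space with a $\sigma$-finite reference measure, and $\ell:\mathbb R^p\times\mathcal Z\to\mathbb R$ a jointly measurable function (log-quasi-likelihood) that is thrice differentiable in $\theta$ for every $z$. Let $\Delta=\{0,1\}^p$; $\|\cdot\|_0$ is the number of non-zero components, $\theta_\delta$ is the component-wise product of $\theta$ and $\delta$, $\mathbb R^p_\delta=\{\theta_\delta:\theta\in\mathbb R^p\}$, and $\delta\supseteq\delta'$ means that $\delta_j=1$ whenever $\delta'_j=1$. For $\rho_0,\rho_1>0$ the quasi-posterior is the probability measure on $\Delta\times\mathbb R^p$ $$\Pi(\delta,\mathrm d\theta\mid z)\propto e^{\ell(\theta_\delta;z)}\,\omega(\delta)\Big(\frac{\rho_1}{2\pi}\Big)^{\frac{\|\delta\|_0}{2}}\Big(\frac{\rho_0}{2\pi}\Big)^{\frac{p-\|\delta\|_0}{2}}e^{-\frac{\rho_1}{2}\|\theta_\delta\|_2^2-\frac{\rho_0}{2}\|\theta-\theta_\delta\|_2^2}\,\mathrm d\theta .$$ Put $\mathcal L_{\theta_1}(\theta;z)=\ell(\theta;z)-\ell(\theta_1;z)-\langle\nabla\ell(\theta_1;z),\theta-\theta_1\rangle$.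 **H1.** $Z\sim f_\star$ for a probability density $f_\star$ on $\mathcal Z$; $\delta_\star\in\Delta$, $\theta_\star\in\mathbb R^p_{\delta_\star}$, $\theta_\star\ne0$, $s_\star=\|\theta_\star\|_0$; $\bar\rho,\bar\kappa>0$; $32\rho_1\|\theta_\star\|_\infty\le\bar\rho$; and $\mathbb P_\star(Z\in\mathcal E_0)>0$, where $\mathcal E_0$ is the set of all $z$ such that $\Pi(\cdot\mid z)$ is well-defined, $\|\nabla\ell(\theta_\star;z)\|_\infty\le\bar\rho/2$, and $\mathcal L_{\theta_\star}(\theta;z)\ge-\frac{\bar\kappa}{2}\|\theta-\theta_\star\|_2^2$ for all $\theta\in\mathbb R^p_{\delta_\star}$. **H2.** $\omega(\delta)=q^{\|\delta\|_0}(1-q)^{p-\|\delta\|_0}$ with $q\in(0,1)$, $\frac{q}{1-q}=p^{-(u+1)}$, $u>0$, and $p^{u/2}\ge2e^{2\rho_1}$. **Contraction rate and sets.** Let $\bar s\ge s_\star$ be an integer and $\mathsf r:[0,\infty)\to[0,\infty)$ a rate function (continuous, increasing, $\mathsf r(0)=0$, $\mathsf r(x)/x\to0$ as $x\downarrow0$).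 Let $$\epsilon=\inf\{y>0:\ \mathsf r(x)-2(s_\star+\bar s)^{1/2}\bar\rho x\ge0\ \text{for all }x\ge y\},$$ $$\mathcal E_1(\bar s)=\mathcal E_0\cap\{z:\ \mathcal L_{\theta_\star}(\theta;z)\le-\tfrac12\mathsf r(\|\theta-\theta_\star\|_2)\ \text{ for all }\delta\text{ with }\|\delta\|_0\le\bar s,\ \theta\in\mathbb R^p_\delta\}.$$ For constants $C,C_1\ge3$ let $\mathcal B^{(\delta)}=\{\theta:\|\theta_\delta-\theta_\star\|_2\le C\epsilon,\ \|\theta-\theta_\delta\|_2\le\sqrt{(1+C_1)\rho_0^{-1}p}\}$, $\mathcal B=\bigcup_{\|\delta\|_0\le\bar s}\{\delta\}\times\mathcal B^{(\delta)}$, $\mathcal A_s=\{\delta:\|\delta\|_0\le s,\ \delta\supseteq\delta_\star\}$ and $\mathcal B_j=\bigcup_{\delta\in\mathcal A_{s_\star+j}}\{\delta\}\times\mathcal B^{(\delta)}$ for $j\ge0$. **Sub-models.** For $u\in\mathbb R^{\|\delta\|_0}$ let $\ell^{[\delta]}(u;z)=\ell((u,0)_\delta;z)$, where $(u,0)_\delta\in\mathbb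 R^p_\delta$ has $\delta$-selected components $u$; let $\hat\theta_\delta=\hat\theta_\delta(z)$ be a maximizer of $\ell^{[\delta]}(\cdot;z)$, and $$\varpi(\delta,a;z)=\sup_{\|u-\hat\theta_\delta\|_2\le a}\ \max_{i,j,k}\Big|\frac{\partial^3\ell^{[\delta]}(u;z)}{\partial u_i\partial u_j\partial u_k}\Big|,\qquad \mathsf a_2=\mathsf a_2(z)=\max_{\delta\in\mathcal A_{\bar s}}\varpi(\delta,(C+1)\epsilon;z)\in[0,\infty].$$ Let $\mathcal E_2(\bar s)$ be the set of all $z\in\mathcal E_1(\bar s)$ such that, for all $1\le j\le\bar s-s_\star$ and all $\delta\in\mathcal A_{\bar s}$ with $\|\delta\|_0=s_\star+j$, $\ell^{[\delta]}(\hat\theta_\delta;z)-\ell^{[\delta_\star]}(\hat\theta_{\delta_\star};z)\le\frac{ju}{2}\log p$. **Theorem.** For every $C\ge3$ there is a constant $C_0>0$, depending only on $C$, such that the following holds. Assume H1, H2 and the strong signal condition $\min_{j:\delta_{\star j}=1}|\theta_{\star j}|>C\epsilon$. Let $C_1\ge3$, $\bar s\ge s_\star$, $\mathcal E\subseteq\mathcal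 E_2(\bar s)$ and $\underline\kappa>0$, and suppose that for all $z\in\mathcal E$, all $\delta\in\mathcal A_{\bar s}$ and all $0\ne v\in\mathbb R^{\|\delta\|_0}$, $$\frac{v'(-\nabla^{(2)}\ell^{[\delta]}(w;z))v}{\|v\|_2^2}\ge\underline\kappa\ \text{ whenever }\|w-\hat\theta_\delta\|_2\le2\epsilon,\qquad \frac{v'(-\nabla^{(2)}\ell^{[\delta]}(w;z))v}{\|v\|_2^2}\le\bar\kappa\ \text{ for all }w\in\mathbb R^{\|\delta\|_0}.$$ Suppose also that $\underline\kappa p^u\ge4\rho_1$ and $(C-1)\epsilon\,\underline\kappa^{1/2}\ge2(s_\star^{1/2}+1)$. Then for all integers $j\ge0$ and all $z\in\mathcal Z$, $$\mathbf 1_{\mathcal E}(z)\big(1-\Pi(\mathcal B_j\mid z)\big)\le 8\,e^{C_0(\rho_1\|\theta_\star\|_\infty\bar s^{1/2}\epsilon+\mathsf a_2\bar s^{3/2}\epsilon^3)}\,e^{\frac{2\mathsf a_2\bar s^3\epsilon}{\underline\kappa}}\Big(\sqrt{\tfrac{\rho_1}{\underline\kappa}}\,\frac1{p^{u/2}}\Big)^{j+1}+\mathbf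 1_{\mathcal E}(z)\,\Pi(\mathcal B^c\mid z).$$ In particular, since $\mathcal B_0\subseteq\{\delta_\star\}\times\mathbb R^p$, the right-hand side with $j=0$ also bounds $\mathbf 1_{\mathcal E}(z)\big(1-\Pi(\delta_\star\mid z)\big)$ (perfect model selection). -/

import Mathlib

open MeasureTheory Filter Topology
open scoped ENNReal

noncomputable section

namespace SpikeSlab

/-- The Euclidean space `ℝ^p`. -/
abbrev Vec (p : ℕ) : Type := EuclideanSpace ℝ (Fin p)

/-- The model space `Δ = {0,1}^p`; `δ j = true` means `δ_j = 1`. -/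
abbrev Mdl (p : ℕ) : Type := Fin p → Bool

/-- The sub-model parameter space `ℝ^{‖δ‖₀}`, indexed by the selected coordinates. -/
abbrev SubVec {p : ℕ} (δ : Mdl p) : Type := EuclideanSpace ℝ {j : Fin p // δ j = true}

/-- `‖δ‖₀`, the number of selected coordinates. -/
def msize {p : ℕ} (δ : Mdl p) : ℕ := (Finset.univ.filter fun j => δ j = true).card

/-- `‖θ‖₀`, the number of non-zero coordinates. -/
def l0 {p : ℕ} (θ : Vec p) : ℕ := (Finset.univ.filter fun j => θ j ≠ 0).card

/-- `‖θ‖_∞`. -/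
def linf {p : ℕ} (θ : Vec p) : ℝ := ⨆ j, |θ j|

/-- `δ ⊇ δ'`. -/
def contains {p : ℕ} (δ δ' : Mdl p) : Prop := ∀ j, δ' j = true → δ j = true

/-- `θ_δ = θ · δ`, the component-wise product. -/
def mask {p : ℕ} (δ : Mdl p) (θ : Vec p) : Vec p :=
  WithLp.toLp 2 fun j => if δ j = true then θ j else 0

/-- The subspace `ℝ^p_δ = {θ · δ : θ ∈ ℝ^p}`. -/
def RpDelta {p : ℕ} (δ : Mdl p) : Set (Vec p) := Set.range (mask δ)

/-- `(u,0)_δ`, the element of `ℝ^p_δ` whose `δ`-selected components are `u`. -/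
def pad {p : ℕ} (δ : Mdl p) (u : SubVec δ) : Vec p :=
  WithLp.toLp 2 fun j => if h : δ j = true then u ⟨j, h⟩ else 0

/-- The log-quasi-likelihood is jointly measurable, and thrice differentiable in `θ`
(the third derivative is not required to be continuous). -/
structure IsQuasiLik {p : ℕ} {Z : Type*} [MeasurableSpace Z] (ℓ : Vec p → Z → ℝ) : Prop where
  meas : Measurable fun x : Vec p × Z => ℓ x.1 x.2
  diff : ∀ z : Z, ∀ k : ℕ, k < 3 →
    Differentiable ℝ (iteratedFDeriv ℝ k fun θ : Vec p => ℓ θ z)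

/-- `𝓛_{θ₁}(θ; z) = ℓ(θ;z) - ℓ(θ₁;z) - ⟨∇ℓ(θ₁;z), θ - θ₁⟩`. -/
def bregman {p : ℕ} {Z : Type*} (ℓ : Vec p → Z → ℝ) (θ₁ θ : Vec p) (z : Z) : ℝ :=
  ℓ θ z - ℓ θ₁ z - inner ℝ (gradient (fun t => ℓ t z) θ₁) (θ - θ₁)

/-! ### The quasi-posterior distribution -/

/-- The prior `ω(δ) = q^{‖δ‖₀} (1-q)^{p-‖δ‖₀}`. -/
def prior {p : ℕ} (q : ℝ) (δ : Mdl p) : ℝ := q ^ msize δ * (1 - q) ^ (p - msize δ)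

/-- The unnormalised quasi-posterior density at `(δ, θ)`. -/
def postDensity {p : ℕ} {Z : Type*} (ℓ : Vec p → Z → ℝ) (q ρ₀ ρ₁ : ℝ) (z : Z)
    (x : Mdl p × Vec p) : ℝ :=
  Real.exp (ℓ (mask x.1 x.2) z) * prior q x.1
    * (ρ₁ / (2 * Real.pi)) ^ ((msize x.1 : ℝ) / 2)
    * (ρ₀ / (2 * Real.pi)) ^ (((p : ℝ) - (msize x.1 : ℝ)) / 2)
    * Real.exp (-(ρ₁ / 2) * ‖mask x.1 x.2‖ ^ 2)
    * Real.exp (-(ρ₀ / 2) * ‖x.2 - mask x.1 x.2‖ ^ 2)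

/-- The unnormalised quasi-posterior measure on `Δ × ℝ^p` (counting measure on `Δ`,
Lebesgue measure on `ℝ^p`). -/
def postUnnorm {p : ℕ} {Z : Type*} (ℓ : Vec p → Z → ℝ) (q ρ₀ ρ₁ : ℝ) (z : Z) :
    Measure (Mdl p × Vec p) :=
  ((Measure.count : Measure (Mdl p)).prod (volume : Measure (Vec p))).withDensity
    fun x => ENNReal.ofReal (postDensity ℓ q ρ₀ ρ₁ z x)

/-- The normalising constant. -/
def normConst {p : ℕ} {Z : Type*} (ℓ : Vec p → Z → ℝ) (q ρ₀ ρ₁ : ℝ) (z : Z) : ℝ≥0∞ :=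
  postUnnorm ℓ q ρ₀ ρ₁ z Set.univ

/-- `Π(·|z)` is well-defined: the normalising constant is positive and finite. -/
def PostWellDefined {p : ℕ} {Z : Type*} (ℓ : Vec p → Z → ℝ) (q ρ₀ ρ₁ : ℝ) (z : Z) : Prop :=
  normConst ℓ q ρ₀ ρ₁ z ≠ 0 ∧ normConst ℓ q ρ₀ ρ₁ z ≠ ⊤

/-- The quasi-posterior `Π(·|z)`; a probability measure whenever it is well-defined. -/
def post {p : ℕ} {Z : Type*} (ℓ : Vec p → Z → ℝ) (q ρ₀ ρ₁ : ℝ) (z : Z) :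
    Measure (Mdl p × Vec p) :=
  (normConst ℓ q ρ₀ ρ₁ z)⁻¹ • postUnnorm ℓ q ρ₀ ρ₁ z

/-! ### Standing assumptions -/

/-- The event `𝓔₀`. -/
def E0 {p : ℕ} {Z : Type*} (ℓ : Vec p → Z → ℝ) (q ρ₀ ρ₁ : ℝ)
    (δs : Mdl p) (θs : Vec p) (ρbar κbar : ℝ) : Set Z :=
  {z | PostWellDefined ℓ q ρ₀ ρ₁ z ∧
    linf (gradient (fun t => ℓ t z) θs) ≤ ρbar / 2 ∧
    ∀ θ ∈ RpDelta δs, -(κbar / 2) * ‖θ - θs‖ ^ 2 ≤ bregman ℓ θs θ z}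

/-- The assumption on the data generating density `f` (with respect to the reference measure `ν`)
and on the true value of the parameter. -/
structure H1 {p : ℕ} {Z : Type*} [MeasurableSpace Z] (ν : Measure Z) (f : Z → ℝ≥0∞)
    (ℓ : Vec p → Z → ℝ) (q ρ₀ ρ₁ : ℝ)
    (δs : Mdl p) (θs : Vec p) (ρbar κbar : ℝ) : Prop where
  f_meas : Measurable f
  f_prob : ∫⁻ z, f z ∂ν = 1
  θs_mem : θs ∈ RpDelta δs
  θs_ne : θs ≠ 0
  ρbar_pos : 0 < ρbar
  κbar_pos : 0 < κbar
  E0_pos : 0 < (ν.withDensity f) (E0 ℓ q ρ₀ ρ₁ δs θs ρbar κbar)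
  ρ₁_le : 32 * ρ₁ * linf θs ≤ ρbar

/-- The assumption on the prior (whose form is built into `prior`). -/
structure H2 (p : ℕ) (q u ρ₁ : ℝ) : Prop where
  u_pos : 0 < u
  q_pos : 0 < q
  q_lt : q < 1
  q_eq : q / (1 - q) = 1 / (p : ℝ) ^ (u + 1)
  p_ge : 9 ≤ p
  p_pow : 2 * Real.exp (2 * ρ₁) ≤ (p : ℝ) ^ (u / 2)

/-! ### Rate functions, contraction rate, strong signal -/

/-- A rate function `r : [0,∞) → [0,∞)`; values at negative arguments play no role. -/
structure IsRate (r : ℝ → ℝ) : Prop where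
  cont : ContinuousOn r (Set.Ici 0)
  nonneg : ∀ x, 0 ≤ x → 0 ≤ r x
  zero : r 0 = 0
  mono : MonotoneOn r (Set.Ici 0)
  lim : Tendsto (fun x => r x / x) (𝓝[>] 0) (𝓝 0)

/-- The set whose infimum is the contraction rate. -/
def rateSet (r : ℝ → ℝ) (sstar sbar : ℕ) (ρbar : ℝ) : Set ℝ :=
  {y | 0 < y ∧ ∀ x, y ≤ x → 0 ≤ r x - 2 * √((sstar : ℝ) + (sbar : ℝ)) * ρbar * x}

/-- The contraction rate `ε`. -/
def rate (r : ℝ → ℝ) (sstar sbar : ℕ) (ρbar : ℝ) : ℝ := sInf (rateSet r sstar sbar ρbar)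

/-- The strong signal condition `min_{j : δ⋆_j = 1} |θ⋆_j| > C ε`. The infimum of the empty set is
`+∞`, so the condition includes that the set defining `ε` is not empty. -/
structure StrongSignal {p : ℕ} (δs : Mdl p) (θs : Vec p) (r : ℝ → ℝ) (sbar : ℕ) (ρbar C : ℝ) :
    Prop where
  finite : (rateSet r (l0 θs) sbar ρbar).Nonempty
  lt : ∀ j, δs j = true → C * rate r (l0 θs) sbar ρbar < |θs j|

/-- The event `𝓔₁(s̄)`. -/
def E1 {p : ℕ} {Z : Type*} (ℓ : Vec p → Z → ℝ) (q ρ₀ ρ₁ : ℝ)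
    (δs : Mdl p) (θs : Vec p) (ρbar κbar : ℝ) (r : ℝ → ℝ) (sbar : ℕ) : Set Z :=
  E0 ℓ q ρ₀ ρ₁ δs θs ρbar κbar ∩
    {z | ∀ δ : Mdl p, msize δ ≤ sbar → ∀ θ ∈ RpDelta δ,
      bregman ℓ θs θ z ≤ -(1 / 2) * r ‖θ - θs‖}

/-! ### Sub-models -/

/-- `ℓ^{[δ]}(u; z) = ℓ((u,0)_δ; z)`. -/
def subLik {p : ℕ} {Z : Type*} (ℓ : Vec p → Z → ℝ) (δ : Mdl p) (z : Z) (u : SubVec δ) : ℝ :=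
  ℓ (pad δ u) z

/-- The estimator `θ̂_δ(z) = argmax_u ℓ^{[δ]}(u; z)` (a maximiser, when there is one). -/
def mle {p : ℕ} {Z : Type*} (ℓ : Vec p → Z → ℝ) (δ : Mdl p) (z : Z) : SubVec δ :=
  Classical.epsilon fun u : SubVec δ => ∀ v : SubVec δ, subLik ℓ δ z v ≤ subLik ℓ δ z u

/-- The quotient `v' (-∇²ℓ^{[δ]}(u; z)) v / ‖v‖²`. -/
def rayleigh {p : ℕ} {Z : Type*} (ℓ : Vec p → Z → ℝ) (δ : Mdl p) (z : Z)
    (u v : SubVec δ) : ℝ :=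
  -(iteratedFDeriv ℝ 2 (subLik ℓ δ z) u ![v, v]) / ‖v‖ ^ 2

/-- `∂³ℓ^{[δ]}(u; z) / ∂u_i ∂u_j ∂u_k`. -/
def thirdPartial {p : ℕ} {Z : Type*} (ℓ : Vec p → Z → ℝ) (δ : Mdl p) (z : Z)
    (u : SubVec δ) (i j k : {j : Fin p // δ j = true}) : ℝ :=
  iteratedFDeriv ℝ 3 (subLik ℓ δ z) u
    ![EuclideanSpace.single i 1, EuclideanSpace.single j 1, EuclideanSpace.single k 1]

/-- `ϖ(δ, a; z)`, the supremum of the third partial derivatives of `ℓ^{[δ]}` over the ball of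
radius `a` about `θ̂_δ`, with values in `[0, ∞]`. -/
def varpi {p : ℕ} {Z : Type*} (ℓ : Vec p → Z → ℝ) (δ : Mdl p) (a : ℝ) (z : Z) : ℝ≥0∞ :=
  ⨆ (u : SubVec δ) (_ : ‖u - mle ℓ δ z‖ ≤ a) (i) (j) (k),
    ENNReal.ofReal |thirdPartial ℓ δ z u i j k|

/-- `𝓐_s = {δ : ‖δ‖₀ ≤ s, δ ⊇ δ⋆}`. -/
def Aset {p : ℕ} (δs : Mdl p) (s : ℕ) : Set (Mdl p) := {δ | msize δ ≤ s ∧ contains δ δs}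

/-- `𝖺₂ = max_{δ ∈ 𝓐_s̄} ϖ(δ, (C+1)ε; z)`, with values in `[0, ∞]`. -/
def a2 {p : ℕ} {Z : Type*} (ℓ : Vec p → Z → ℝ) (δs : Mdl p) (sbar : ℕ) (C ε : ℝ) (z : Z) :
    ℝ≥0∞ :=
  ⨆ δ ∈ Aset δs sbar, varpi ℓ δ ((C + 1) * ε) z

/-- The event `𝓔₂(s̄)`. -/
def E2 {p : ℕ} {Z : Type*} (ℓ : Vec p → Z → ℝ) (q ρ₀ ρ₁ u : ℝ)
    (δs : Mdl p) (θs : Vec p) (ρbar κbar : ℝ) (r : ℝ → ℝ) (sbar : ℕ) : Set Z :=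
  E1 ℓ q ρ₀ ρ₁ δs θs ρbar κbar r sbar ∩
    {z | ∀ j : ℕ, 1 ≤ j → j ≤ sbar - l0 θs →
      ∀ δ ∈ Aset δs sbar, msize δ = l0 θs + j →
        subLik ℓ δ z (mle ℓ δ z) - subLik ℓ δs z (mle ℓ δs z)
          ≤ (j : ℝ) * u / 2 * Real.log (p : ℝ)}

/-! ### The contraction sets -/

/-- `𝓑^{(δ)}`. -/
def Bdelta {p : ℕ} (θs : Vec p) (ρ₀ C C₁ ε : ℝ) (δ : Mdl p) : Set (Vec p) :=
  {θ | ‖mask δ θ - θs‖ ≤ C * ε ∧ ‖θ - mask δ θ‖ ≤ √((1 + C₁) * ρ₀⁻¹ * (p : ℝ))}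

/-- `𝓑 = ⋃_{‖δ‖₀ ≤ s̄} {δ} × 𝓑^{(δ)}`. -/
def Bset {p : ℕ} (θs : Vec p) (ρ₀ C C₁ ε : ℝ) (sbar : ℕ) : Set (Mdl p × Vec p) :=
  {x | msize x.1 ≤ sbar ∧ x.2 ∈ Bdelta θs ρ₀ C C₁ ε x.1}

/-- `𝓑_j = ⋃_{δ ∈ 𝓐_{s⋆+j}} {δ} × 𝓑^{(δ)}`. -/
def Bj {p : ℕ} (δs : Mdl p) (θs : Vec p) (ρ₀ C C₁ ε : ℝ) (j : ℕ) : Set (Mdl p × Vec p) :=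
  {x | x.1 ∈ Aset δs (l0 θs + j) ∧ x.2 ∈ Bdelta θs ρ₀ C C₁ ε x.1}

/-- The main term of the bound,
`8 exp(C₀(ρ₁ ‖θ⋆‖_∞ s̄^{1/2} ε + a s̄^{3/2} ε³)) exp(2 a s̄³ ε / κ) (√(ρ₁/κ) p^{-u/2})^{j+1}`,
as an extended non-negative number (it is `∞` if `a = ∞`). -/
def selBound {p : ℕ} (C₀ ρ₁ : ℝ) (θs : Vec p) (sbar : ℕ) (ε : ℝ) (a : ℝ≥0∞) (κ u : ℝ) (j : ℕ) :
    ℝ≥0∞ :=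
  8 * EReal.exp ((C₀ : EReal) *
        (((ρ₁ * linf θs * √(sbar : ℝ) * ε : ℝ) : EReal)
          + (a : EReal) * (((sbar : ℝ) ^ (3 / 2 : ℝ) * ε ^ 3 : ℝ) : EReal)))
    * EReal.exp ((a : EReal) * ((2 * (sbar : ℝ) ^ 3 * ε / κ : ℝ) : EReal))
    * ENNReal.ofReal ((√(ρ₁ / κ) * (1 / (p : ℝ) ^ (u / 2))) ^ (j + 1))

end SpikeSlab

end

open SpikeSlab

/-! The posterior mass outside `Bj` is at most the mass of `Bset \ Bj` plus that of the complement
of `Bset`. On `Bset` the strong signal forces the model to contain δ⋆ (`contains_of_mem_Bdelta`), so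
`Bset \ Bj` splits into sections over models δ ⊇ δ⋆ with m > j spurious coordinates. Each section is
compared with the mass of the true model.

The comparison is a two-sided Laplace approximation (`sectionMass_Bdelta_le`). Maximisers of the
sub-model likelihoods exist and lie within ε of θ⋆, because beyond ε the rate function beats the
gradient term (`lik_lt_of_rate_lt`). A Taylor expansion about the maximiser has no linear term and a
cubic remainder controlled by 𝖺₂. This bounds the section of δ above by a full Gaussian integral,
and the section of δ⋆ below by the part of one on a ball, which is at least half of it
(`gaussMass_le_two_mul_setLIntegral`).

The Gaussian integrals are compared without evaluating a determinant of a Hessian. Integrating out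
the m extra coordinates by a Schur complement costs (ρ₀/κ)^{m/2} (`gaussMass_le_of_contains`). The
Hessians at the two maximisers are then close on the coordinates of δ⋆ (`gaussMass_le_exp_mul`).

The prior contributes p^{-(u+1)m} (ρ₁/ρ₀)^{m/2}, and on `E2` the likelihood ratio is at most
p^{um/2}. Up to the Laplace errors, each section therefore has mass at most 2(x/p)^m with x =
√(ρ₁/κ) p^{-u/2}. There are at most p^m models with m spurious coordinates, and x ≤ 1/2, so the sum
over m > j is geometric (`sum_contains_pow_le`). -/

noncomputable section
namespace SpikeSlab

/-! ### Masks and coordinates -/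

section Coordinates

variable {p : ℕ}

@[simp] lemma mask_apply (δ : Mdl p) (θ : Vec p) (j : Fin p) :
    mask δ θ j = if δ j = true then θ j else 0 := rfl

@[simp] lemma pad_apply (δ : Mdl p) (u : SubVec δ) (j : Fin p) :
    pad δ u j = if h : δ j = true then u ⟨j, h⟩ else 0 := rfl

/-- Masking as a linear map. -/
def maskL (δ : Mdl p) : Vec p →ₗ[ℝ] Vec p where
  toFun := mask δ
  map_add' x y := by ext j; by_cases h : δ j = true <;> simp [h]
  map_smul' c x := by ext j; by_cases h : δ j = true <;> simp [h]

@[simp] lemma maskL_apply (δ : Mdl p) (θ : Vec p) : maskL δ θ = mask δ θ := rfl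

lemma mask_add (δ : Mdl p) (x y : Vec p) : mask δ (x + y) = mask δ x + mask δ y :=
  map_add (maskL δ) x y

lemma mask_sub (δ : Mdl p) (x y : Vec p) : mask δ (x - y) = mask δ x - mask δ y :=
  map_sub (maskL δ) x y

lemma continuous_mask (δ : Mdl p) : Continuous (mask δ) :=
  (maskL δ).continuous_of_finiteDimensional

/-- Padding as a linear map. -/
def padL (δ : Mdl p) : SubVec δ →ₗ[ℝ] Vec p where
  toFun := pad δ
  map_add' x y := by ext j; by_cases h : δ j = true <;> simp [h]
  map_smul' c x := by ext j; by_cases h : δ j = true <;> simp [h]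

/-- Padding as a continuous linear map. -/
def padCL (δ : Mdl p) : SubVec δ →L[ℝ] Vec p := LinearMap.toContinuousLinearMap (padL δ)

@[simp] lemma padCL_apply (δ : Mdl p) (u : SubVec δ) : padCL δ u = pad δ u := rfl

/-- The selected coordinates of a vector. -/
def sel (δ : Mdl p) (θ : Vec p) : SubVec δ := WithLp.toLp 2 fun j => θ j.1

@[simp] lemma sel_apply (δ : Mdl p) (θ : Vec p) (j) : sel δ θ j = θ j.1 := rfl

lemma pad_sel (δ : Mdl p) (θ : Vec p) : pad δ (sel δ θ) = mask δ θ := by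
  ext j; by_cases h : δ j = true <;> simp [h]

lemma pad_sub (δ : Mdl p) (x y : SubVec δ) : pad δ (x - y) = pad δ x - pad δ y :=
  map_sub (padCL δ) x y

lemma mask_pad (δ : Mdl p) (u : SubVec δ) : mask δ (pad δ u) = pad δ u := by
  ext j; by_cases h : δ j = true <;> simp [h]

lemma mask_mask (δ : Mdl p) (θ : Vec p) : mask δ (mask δ θ) = mask δ θ := by
  ext j; by_cases h : δ j = true <;> simp [h]

lemma norm_pad (δ : Mdl p) (u : SubVec δ) : ‖pad δ u‖ = ‖u‖ := by
  have h : ‖pad δ u‖ ^ 2 = ‖u‖ ^ 2 := by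
    rw [EuclideanSpace.real_norm_sq_eq, EuclideanSpace.real_norm_sq_eq]
    refine (Fintype.sum_of_injective Subtype.val Subtype.val_injective _ _ (fun j hj => ?_)
      fun j => ?_).symm
    · have : ¬ δ j = true := by simpa using hj
      simp [this]
    · simp [j.2]
  exact (sq_eq_sq₀ (norm_nonneg _) (norm_nonneg _)).mp h

lemma norm_sq_eq_mask_add (δ : Mdl p) (θ : Vec p) :
    ‖θ‖ ^ 2 = ‖mask δ θ‖ ^ 2 + ‖θ - mask δ θ‖ ^ 2 := by
  simp only [EuclideanSpace.real_norm_sq_eq, ← Finset.sum_add_distrib]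
  refine Finset.sum_congr rfl fun j _ => ?_
  by_cases h : δ j = true <;> simp [h]

lemma mask_mask_of_contains {δ δ' : Mdl p} (h : contains δ δ') (θ : Vec p) :
    mask δ (mask δ' θ) = mask δ' θ := by
  ext j
  by_cases h' : δ' j = true
  · simp [h', h j h']
  · simp [h']

lemma msize_le (δ : Mdl p) : msize δ ≤ p :=
  (Finset.card_filter_le _ _).trans (by simp)

/-- Coordinatewise rescaling. -/
def diagL (d : Fin p → ℝ) : Vec p →ₗ[ℝ] Vec p where
  toFun θ := WithLp.toLp 2 fun j => d j * θ j
  map_add' x y := by ext j; simp [mul_add]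
  map_smul' c x := by ext j; simp; ring

@[simp] lemma diagL_apply (d : Fin p → ℝ) (θ : Vec p) (j : Fin p) :
    diagL d θ j = d j * θ j := rfl

lemma det_diagL (d : Fin p → ℝ) : LinearMap.det (diagL d) = ∏ j, d j := by
  have : diagL d = Matrix.toLin (EuclideanSpace.basisFun (Fin p) ℝ).toBasis
      (EuclideanSpace.basisFun (Fin p) ℝ).toBasis (Matrix.diagonal d) := by
    rw [← LinearMap.toMatrix_symm, LinearEquiv.eq_symm_apply]
    ext i j
    simp [LinearMap.toMatrix_apply, Matrix.diagonal_apply]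
  rw [this, LinearMap.det_toLin, Matrix.det_diagonal]

end Coordinates

/-! ### Gaussian integrals -/

section Gaussian

/-- An invertible linear map is a measurable embedding, so the change of variables needs no
measurability of g. -/
lemma lintegral_comp_linearMap {E : Type*} [NormedAddCommGroup E] [NormedSpace ℝ E]
    [MeasurableSpace E] [BorelSpace E] [FiniteDimensional ℝ E] (μ : Measure E)
    [μ.IsAddHaarMeasure] {T : E →ₗ[ℝ] E} (hT : LinearMap.det T ≠ 0) (g : E → ℝ≥0∞) :
    ∫⁻ x, g (T x) ∂μ = ENNReal.ofReal |(LinearMap.det T)⁻¹| * ∫⁻ x, g x ∂μ := by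
  have hemb : MeasurableEmbedding T :=
    (LinearMap.equivOfDetNeZero T hT).toContinuousLinearEquiv.toHomeomorph.measurableEmbedding
  rw [← hemb.lintegral_map, Measure.map_linearMap_addHaar_eq_smul_addHaar μ hT,
    lintegral_smul_measure, smul_eq_mul]

/-- Conjugation by the involution σ turns 1 + N into 1 − N, its inverse because N² = 0. So 1 + N and
its inverse have the same determinant, whose square is 1. -/
lemma abs_det_id_add_of_flip {E : Type*} [AddCommGroup E] [Module ℝ E] [FiniteDimensional ℝ E]
    (N σ : E →ₗ[ℝ] E) (hN : N ∘ₗ N = 0) (hσ : σ ∘ₗ σ = LinearMap.id)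
    (hflip : σ ∘ₗ N ∘ₗ σ = -N) : |LinearMap.det (LinearMap.id + N)| = 1 := by
  have h1 : (LinearMap.id + N) ∘ₗ (σ ∘ₗ (LinearMap.id + N) ∘ₗ σ) = LinearMap.id := by
    have : σ ∘ₗ (LinearMap.id + N) ∘ₗ σ = LinearMap.id - N := by
      rw [LinearMap.add_comp, LinearMap.comp_add, LinearMap.id_comp, hσ, hflip, sub_eq_add_neg]
    rw [this, LinearMap.comp_sub, LinearMap.add_comp, LinearMap.add_comp, hN]
    simp
  have h2 := congrArg LinearMap.det h1
  have h3 := congrArg LinearMap.det hσ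
  simp only [LinearMap.det_comp, LinearMap.det_id] at h2 h3
  have h4 : LinearMap.det (LinearMap.id + N) ^ 2 = 1 := by
    linear_combination h2 - LinearMap.det (LinearMap.id + N) ^ 2 * h3
  rw [← abs_one, ← sq_eq_sq_iff_abs_eq_abs, h4, one_pow]

variable {p : ℕ}

/-- The Gaussian density with quadratic form `B` on the selected coordinates and precision `ρ₀`
on the others, not normalised. -/
def gaussDens (ρ₀ : ℝ) (δ : Mdl p) (B : Vec p →L[ℝ] Vec p →L[ℝ] ℝ) (θ : Vec p) : ℝ≥0∞ :=
  ENNReal.ofReal (Real.exp (-(1 / 2) * B (mask δ θ) (mask δ θ)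
    - ρ₀ / 2 * ‖θ - mask δ θ‖ ^ 2))

/-- The total mass of `gaussDens`. -/
def gaussMass (ρ₀ : ℝ) (δ : Mdl p) (B : Vec p →L[ℝ] Vec p →L[ℝ] ℝ) : ℝ≥0∞ :=
  ∫⁻ θ, gaussDens ρ₀ δ B θ

lemma gaussMass_anti {ρ₀ : ℝ} {δ : Mdl p} {B B' : Vec p →L[ℝ] Vec p →L[ℝ] ℝ}
    (h : ∀ θ, B (mask δ θ) (mask δ θ) ≤ B' (mask δ θ) (mask δ θ)) :
    gaussMass ρ₀ δ B' ≤ gaussMass ρ₀ δ B := by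
  refine lintegral_mono fun θ => ENNReal.ofReal_le_ofReal (Real.exp_le_exp.mpr ?_)
  linarith [h θ]

lemma prod_ite_pow (δ : Mdl p) (t : ℝ) :
    ∏ j, (if δ j = true then t else 1) = t ^ msize δ := by
  rw [Finset.prod_ite, Finset.prod_const_one, mul_one, Finset.prod_const, msize]

lemma gaussMass_sq_smul {t : ℝ} (ht : 0 < t) (ρ₀ : ℝ) (δ : Mdl p)
    (B : Vec p →L[ℝ] Vec p →L[ℝ] ℝ) :
    gaussMass ρ₀ δ (t ^ 2 • B) = ENNReal.ofReal ((t ^ msize δ)⁻¹) * gaussMass ρ₀ δ B := by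
  set T : Vec p →ₗ[ℝ] Vec p := diagL fun j => if δ j = true then t else 1 with hT
  have hdet : LinearMap.det T = t ^ msize δ := by rw [hT, det_diagL, prod_ite_pow]
  have hpos : 0 < t ^ msize δ := by positivity
  have key : ∀ θ, gaussDens ρ₀ δ (t ^ 2 • B) θ = gaussDens ρ₀ δ B (T θ) := by
    intro θ
    have h1 : mask δ (T θ) = t • mask δ θ := by
      ext j; by_cases h : δ j = true <;> simp [hT, h]
    have h2 : T θ - mask δ (T θ) = θ - mask δ θ := by
      ext j; by_cases h : δ j = true <;> simp [hT, h]
    rw [gaussDens, gaussDens, h2, h1]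
    congr 3
    simp
    ring
  rw [gaussMass, lintegral_congr key, lintegral_comp_linearMap _ (by rw [hdet]; exact hpos.ne'),
    hdet, abs_of_pos (inv_pos.mpr hpos), gaussMass]

lemma gaussMass_lt_top {ρ₀ κ : ℝ} (hρ₀ : 0 < ρ₀) (hκ : 0 < κ) {δ : Mdl p}
    {B : Vec p →L[ℝ] Vec p →L[ℝ] ℝ}
    (hB : ∀ θ, κ * ‖mask δ θ‖ ^ 2 ≤ B (mask δ θ) (mask δ θ)) : gaussMass ρ₀ δ B < ⊤ := by
  have hint : Integrable (fun θ : Vec p => Real.exp (-(min κ ρ₀ / 2) * ‖θ‖ ^ 2)) := by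
    have h := (GaussianFourier.integrable_cexp_neg_mul_sq_norm_add (V := Vec p)
      (b := ((min κ ρ₀ / 2 : ℝ) : ℂ)) (by simp [hρ₀, hκ]) 0 0).re
    refine h.congr (Eventually.of_forall fun θ => ?_)
    simp only [zero_mul, add_zero]
    rw [← Complex.ofReal_neg, ← Complex.ofReal_pow, ← Complex.ofReal_mul, ← Complex.ofReal_exp]
    exact Complex.ofReal_re _
  refine lt_of_le_of_lt (lintegral_mono fun θ => ?_) hint.lintegral_lt_top
  refine ENNReal.ofReal_le_ofReal (Real.exp_le_exp.mpr ?_)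
  rw [norm_sq_eq_mask_add δ θ]
  nlinarith [hB θ, mul_le_mul_of_nonneg_right (min_le_left κ ρ₀) (sq_nonneg ‖mask δ θ‖),
    mul_le_mul_of_nonneg_right (min_le_right κ ρ₀) (sq_nonneg ‖θ - mask δ θ‖)]

/-- A Gaussian with precision at least `κ` in `‖δ‖₀` dimensions puts half of its mass on a ball
whose radius is twice the square root of the dimension, in standard units. -/
lemma gaussMass_le_two_mul_setLIntegral {ρ₀ κ R : ℝ} (hρ₀ : 0 < ρ₀) (hκ : 0 < κ)
    {δ : Mdl p} (hR : 2 * (√(msize δ : ℝ) + 1) ≤ R * √κ)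
    {B : Vec p →L[ℝ] Vec p →L[ℝ] ℝ}
    (hB : ∀ θ, κ * ‖mask δ θ‖ ^ 2 ≤ B (mask δ θ) (mask δ θ)) :
    gaussMass ρ₀ δ B ≤ 2 * ∫⁻ θ in {θ | ‖mask δ θ‖ ≤ R}, gaussDens ρ₀ δ B θ := by
  set A : Set (Vec p) := {θ | ‖mask δ θ‖ ≤ R} with hA
  have hAm : MeasurableSet A :=
    (isClosed_le (continuous_mask δ).norm continuous_const).measurableSet
  have hs := Real.sqrt_nonneg (msize δ : ℝ)
  have hs2 := Real.sq_sqrt (Nat.cast_nonneg (α := ℝ) (msize δ))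
  have hκR : 4 * (msize δ + 1) ≤ κ * R ^ 2 := by
    have h1 : κ * R ^ 2 = (R * √κ) ^ 2 := by rw [mul_pow, Real.sq_sqrt hκ.le]; ring
    rw [h1]
    nlinarith
  have hR0 : 0 ≤ R := by
    by_contra! h
    nlinarith [Real.sqrt_nonneg κ]
  have hcompl : ∫⁻ θ in Aᶜ, gaussDens ρ₀ δ B θ ≤ ENNReal.ofReal (1 / 2) * gaussMass ρ₀ δ B := by
    -- Chernoff argument: off the ball B ≥ 4(d + 1), where d is the model size. Half of the exponent
    -- gives e^{-(d+1)}, and the other half is a Gaussian of half the precision, whose mass is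
    -- larger by only √2^d.
    have step : ∫⁻ θ in Aᶜ, gaussDens ρ₀ δ B θ
        ≤ ENNReal.ofReal (Real.exp (-(msize δ + 1))) * gaussMass ρ₀ δ (((1 / √2) ^ 2 : ℝ) • B) := by
      rw [gaussMass, ← lintegral_const_mul' _ _ ENNReal.ofReal_ne_top]
      refine le_trans (setLIntegral_mono' hAm.compl fun θ hθ => ?_) (setLIntegral_le_lintegral _ _)
      rw [gaussDens, gaussDens, ← ENNReal.ofReal_mul (Real.exp_pos _).le, ← Real.exp_add]
      refine ENNReal.ofReal_le_ofReal (Real.exp_le_exp.mpr ?_)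
      have hθ' : R < ‖mask δ θ‖ := by simpa [hA] using hθ
      have h3 : (1 / √2 : ℝ) ^ 2 = 1 / 2 := by
        rw [div_pow, Real.sq_sqrt (by norm_num)]; norm_num
      have h4 : R ^ 2 ≤ ‖mask δ θ‖ ^ 2 := by gcongr
      have h5 := mul_le_mul_of_nonneg_left h4 hκ.le
      simp only [h3, smul_apply, smul_eq_mul]
      linarith [hB θ]
    refine step.trans ?_
    rw [gaussMass_sq_smul (by positivity), ← mul_assoc, ← ENNReal.ofReal_mul (Real.exp_pos _).le]
    gcongr
    have h2 : (((1 / √2 : ℝ)) ^ msize δ)⁻¹ = √2 ^ msize δ := by simp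
    have h6 : √2 ^ msize δ ≤ Real.exp (msize δ) := by
      rw [← Real.exp_one_pow]
      gcongr
      have := Real.add_one_le_exp (1 : ℝ)
      have h7 : √2 ≤ 2 := by
        rw [Real.sqrt_le_left (by norm_num)]; norm_num
      linarith
    have h8 : Real.exp (-(msize δ + 1)) = (Real.exp (msize δ))⁻¹ * (Real.exp 1)⁻¹ := by
      rw [← Real.exp_neg, ← Real.exp_neg, ← Real.exp_add]; congr 1; ring
    have h9 : (Real.exp 1)⁻¹ ≤ 1 / 2 := by
      rw [one_div]
      gcongr
      linarith [Real.add_one_le_exp (1 : ℝ)]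
    rw [h2, h8]
    calc (Real.exp (msize δ))⁻¹ * (Real.exp 1)⁻¹ * √2 ^ msize δ
        ≤ (Real.exp (msize δ))⁻¹ * (1 / 2) * Real.exp (msize δ) := by gcongr
      _ = 1 / 2 := by field_simp
  -- Finiteness permits cancellation: with a the mass inside and b the mass outside, b ≤ (a + b)/2
  -- gives a + b ≤ 2a.
  have hfin := gaussMass_lt_top hρ₀ hκ hB
  have hsplit : gaussMass ρ₀ δ B
      = (∫⁻ θ in A, gaussDens ρ₀ δ B θ) + ∫⁻ θ in Aᶜ, gaussDens ρ₀ δ B θ :=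
    (lintegral_add_compl _ hAm).symm
  have h1 : ∫⁻ θ in A, gaussDens ρ₀ δ B θ ≠ ⊤ :=
    (lt_of_le_of_lt (setLIntegral_le_lintegral _ _) hfin).ne
  have h2 : ∫⁻ θ in Aᶜ, gaussDens ρ₀ δ B θ ≠ ⊤ :=
    (lt_of_le_of_lt (setLIntegral_le_lintegral _ _) hfin).ne
  rw [hsplit] at hcompl ⊢
  clear hsplit
  generalize ∫⁻ θ in A, gaussDens ρ₀ δ B θ = a at *
  generalize ∫⁻ θ in Aᶜ, gaussDens ρ₀ δ B θ = b at *
  lift a to NNReal using h1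
  lift b to NNReal using h2
  have h12 : ENNReal.ofReal (1 / 2) = ((1 / 2 : NNReal) : ℝ≥0∞) := by
    rw [ENNReal.ofReal]; congr 1; ext; norm_num
  rw [h12] at hcompl
  norm_cast at hcompl ⊢
  rw [← NNReal.coe_le_coe] at hcompl ⊢
  push_cast at hcompl ⊢
  linarith

/-- The coordinates in `δ` but not in `δ'`. -/
def mdiff (δ δ' : Mdl p) : Mdl p := fun j => δ j && !δ' j

lemma msize_mdiff {δ δ' : Mdl p} (h : contains δ δ') :
    msize (mdiff δ δ') = msize δ - msize δ' := by
  have : (Finset.univ.filter fun j => mdiff δ δ' j = true)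
      = (Finset.univ.filter fun j => δ j = true) \ (Finset.univ.filter fun j => δ' j = true) := by
    ext j; simp [mdiff]
  rw [msize, this, Finset.card_sdiff_of_subset, msize, msize]
  intro j hj
  simp only [Finset.mem_filter, Finset.mem_univ, true_and] at hj ⊢
  exact h j hj

/-- Coercivity makes B injective from the sub-model into its dual, hence bijective by dimension, and
N θ represents the functional B(θ_τ, ·) there. Thus −N θ minimises w ↦ B(w + θ_τ, w + θ_τ) over the
sub-model (B symmetric): this is the map that completes the square. -/
lemma exists_partial_minimizer {κ : ℝ} (hκ : 0 < κ) {δ : Mdl p} (τ : Mdl p)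
    {B : Vec p →L[ℝ] Vec p →L[ℝ] ℝ}
    (hB : ∀ θ, κ * ‖mask δ θ‖ ^ 2 ≤ B (mask δ θ) (mask δ θ)) :
    ∃ N : Vec p →ₗ[ℝ] Vec p, (∀ θ, mask δ (N θ) = N θ) ∧ (∀ θ, N (mask τ θ) = N θ) ∧
      ∀ θ w, B (N θ) (mask δ w) = B (mask τ θ) (mask δ w) := by
  set Φ : SubVec δ →ₗ[ℝ] Module.Dual ℝ (SubVec δ) :=
    { toFun := fun u => (B (pad δ u)).toLinearMap ∘ₗ padL δ
      map_add' := fun x y => by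
        rw [show pad δ (x + y) = pad δ x + pad δ y from map_add (padL δ) x y, map_add]; rfl
      map_smul' := fun c x => by
        rw [show pad δ (c • x) = c • pad δ x from map_smul (padL δ) c x, map_smul]; rfl } with hΦ
  have hΦa : ∀ u v, Φ u v = B (pad δ u) (pad δ v) := fun u v => rfl
  have hinj : Function.Injective Φ := by
    rw [← LinearMap.ker_eq_bot, LinearMap.ker_eq_bot']
    intro u hu
    have h1 : B (pad δ u) (pad δ u) = 0 := by rw [← hΦa, hu]; rfl
    have h2 := hB (pad δ u)
    rw [mask_pad, h1, norm_pad] at h2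
    have h3 : ‖u‖ ^ 2 ≤ 0 := by
      by_contra! h
      nlinarith
    exact norm_eq_zero.mp (pow_eq_zero_iff (two_ne_zero) |>.mp (le_antisymm h3 (sq_nonneg _)))
  set e := LinearMap.linearEquivOfInjective Φ hinj Subspace.dual_finrank_eq.symm
  set Ψ : Vec p →ₗ[ℝ] Module.Dual ℝ (SubVec δ) :=
    { toFun := fun θ => (B (mask τ θ)).toLinearMap ∘ₗ padL δ
      map_add' := fun x y => by rw [mask_add, map_add]; rfl
      map_smul' := fun c x => by
        rw [show mask τ (c • x) = c • mask τ x from map_smul (maskL τ) c x, map_smul]; rfl }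
  have hΨa : ∀ θ v, Ψ θ v = B (mask τ θ) (pad δ v) := fun u v => rfl
  refine ⟨padL δ ∘ₗ e.symm.toLinearMap ∘ₗ Ψ, fun θ => mask_pad δ _, fun θ => ?_, fun θ w => ?_⟩
  · have : Ψ (mask τ θ) = Ψ θ := by
      ext v; rw [hΨa, hΨa, mask_mask]
    simp [this]
  · rw [← pad_sel δ w, ← hΨa]
    have : Ψ θ = Φ (e.symm (Ψ θ)) := (e.apply_symm_apply (Ψ θ)).symm
    conv_rhs => rw [this, hΦa]
    rfl

/-- Integrating out the coordinates outside a sub-model costs at most the corresponding Gaussian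
normalising constant with precision `κ`. -/
lemma gaussMass_le_of_contains {ρ₀ κ : ℝ} (hρ₀ : 0 < ρ₀) (hκ : 0 < κ) {δ δ' : Mdl p}
    (hδ : contains δ δ') {B : Vec p →L[ℝ] Vec p →L[ℝ] ℝ} (hsymm : ∀ v w, B v w = B w v)
    (hB : ∀ θ, κ * ‖mask δ θ‖ ^ 2 ≤ B (mask δ θ) (mask δ θ)) :
    gaussMass ρ₀ δ B ≤ ENNReal.ofReal (√(ρ₀ / κ) ^ (msize δ - msize δ')) * gaussMass ρ₀ δ' B := by
  have hB' : ∀ θ, κ * ‖mask δ' θ‖ ^ 2 ≤ B (mask δ' θ) (mask δ' θ) := fun θ => by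
    have := hB (mask δ' θ)
    rwa [mask_mask_of_contains hδ] at this
  set τ := mdiff δ δ' with hτ
  obtain ⟨N, hN1, hN2, hN3⟩ := exists_partial_minimizer hκ τ hB'
  have hτN : ∀ θ, mask τ (N θ) = 0 := fun θ => by
    rw [← hN1]; ext j
    by_cases h : δ' j = true <;> simp [hτ, mdiff, h]
  have hNN : N ∘ₗ N = 0 := by
    ext1 θ
    rw [LinearMap.comp_apply, ← hN2 (N θ), hτN, map_zero, LinearMap.zero_apply]
  -- N sends the τ-coordinates into the δ'-coordinates, so flipping signs on δ' negates it.
  set σ : Vec p →ₗ[ℝ] Vec p := diagL fun j => if δ' j = true then -1 else 1 with hσ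
  have hσσ : σ ∘ₗ σ = LinearMap.id := by
    ext θ j
    by_cases h : δ' j = true <;> simp [hσ, h]
  have hflip : σ ∘ₗ N ∘ₗ σ = -N := by
    have h1 : ∀ θ, N (σ θ) = N θ := fun θ => by
      rw [← hN2, ← hN2 θ]
      congr 1
      ext j
      by_cases h : δ' j = true <;> simp [hσ, hτ, mdiff, h]
    ext1 θ
    rw [LinearMap.comp_apply, LinearMap.comp_apply, h1, LinearMap.neg_apply, ← hN1]
    ext j
    by_cases h : δ' j = true <;> simp [hσ, h]
  have hdet1 := abs_det_id_add_of_flip N σ hNN hσσ hflip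
  -- The substitution θ ↦ S(θ + N θ) completes the square and rescales the extra coordinates, so
  -- that their precision κ becomes the spike precision ρ₀.
  set t := √(κ / ρ₀) with ht
  have htpos : 0 < t := Real.sqrt_pos.mpr (by positivity)
  have ht2 : ρ₀ * t ^ 2 = κ := by rw [ht, Real.sq_sqrt (by positivity)]; field_simp
  set S : Vec p →ₗ[ℝ] Vec p := diagL fun j => if τ j = true then t else 1 with hS
  have hdet2 : LinearMap.det S = t ^ (msize δ - msize δ') := by
    rw [hS, det_diagL, prod_ite_pow, hτ, msize_mdiff hδ]
  have hdet : |(LinearMap.det (S ∘ₗ (LinearMap.id + N)))⁻¹| = √(ρ₀ / κ) ^ (msize δ - msize δ') := by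
    rw [LinearMap.det_comp, abs_inv, abs_mul, hdet1, mul_one, hdet2, abs_of_pos (by positivity),
      ← inv_pow, ht, ← Real.sqrt_inv, inv_div]
  have hdet0 : LinearMap.det (S ∘ₗ (LinearMap.id + N)) ≠ 0 := by
    intro h
    have hpos : 0 < √(ρ₀ / κ) ^ (msize δ - msize δ') := by positivity
    rw [h] at hdet
    simp only [inv_zero, abs_zero] at hdet
    exact hpos.ne hdet
  rw [← hdet, gaussMass, gaussMass, ← lintegral_comp_linearMap volume hdet0]
  refine lintegral_mono fun θ => ENNReal.ofReal_le_ofReal (Real.exp_le_exp.mpr ?_)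
  have e1 : mask δ' ((S ∘ₗ (LinearMap.id + N)) θ) = mask δ' θ + N θ := by
    rw [← hN1 θ]; ext j
    by_cases h : δ' j = true <;> simp [hS, hτ, mdiff, h]
  have e2 : ‖(S ∘ₗ (LinearMap.id + N)) θ - mask δ' ((S ∘ₗ (LinearMap.id + N)) θ)‖ ^ 2
      = t ^ 2 * ‖mask τ θ‖ ^ 2 + ‖θ - mask δ θ‖ ^ 2 := by
    simp only [EuclideanSpace.real_norm_sq_eq, Finset.mul_sum, ← Finset.sum_add_distrib]
    refine Finset.sum_congr rfl fun j _ => ?_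
    have h0 : δ' j ≠ true → (N θ).ofLp j = 0 := fun h => by
      rw [← hN1]; simp [h]
    by_cases h : δ' j = true
    · simp [hS, hτ, mdiff, h, hδ j h]
    · by_cases h' : δ j = true <;> simp [hS, hτ, mdiff, h, h', h0 h, mul_pow]
  -- The two summands are B-orthogonal. The second has B-value at least κ‖θ_τ‖², since N θ is
  -- supported away from τ and can only increase the norm.
  have e3 : mask δ θ = (mask δ' θ + N θ) + (mask τ θ - N θ) := by
    ext j
    by_cases h : δ' j = true
    · simp [hτ, mdiff, h, hδ j h]
    · by_cases h' : δ j = true <;> simp [hτ, mdiff, h, h']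
  have e4 : mask δ (mask τ θ - N θ) = mask τ θ - N θ := by
    rw [mask_sub, ← hN1 θ, mask_mask_of_contains hδ]
    congr 1
    ext j
    by_cases h' : δ j = true <;> simp [hτ, mdiff, h']
  have e5 : ‖mask τ θ‖ ^ 2 ≤ ‖mask τ θ - N θ‖ ^ 2 := by
    simp only [EuclideanSpace.real_norm_sq_eq]
    refine Finset.sum_le_sum fun j _ => ?_
    rw [← hN1 θ]
    by_cases h : δ' j = true
    · simp [hτ, mdiff, h, sq_nonneg]
    · simp [hτ, mdiff, h]
  have e6 : B (mask τ θ - N θ) (mask δ' θ + N θ) = 0 := by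
    have : mask δ' θ + N θ = mask δ' (θ + N θ) := by rw [mask_add, hN1]
    rw [this, map_sub, sub_apply, hN3, sub_self]
  have e7 := hB (mask τ θ - N θ)
  rw [e4] at e7
  have e8 : B (mask δ θ) (mask δ θ) = B (mask δ' θ + N θ) (mask δ' θ + N θ)
      + B (mask τ θ - N θ) (mask τ θ - N θ) := by
    conv_lhs => rw [e3]
    generalize mask τ θ - N θ = b at e6 ⊢
    generalize mask δ' θ + N θ = a at e6 ⊢
    simp only [map_add, add_apply]
    rw [hsymm a b, e6]; ring
  rw [e2, e1, e8]
  have e9 := mul_le_mul_of_nonneg_left e5 hκ.le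
  have e10 : ρ₀ / 2 * (t ^ 2 * ‖mask τ θ‖ ^ 2 + ‖θ - mask δ θ‖ ^ 2)
      = κ * ‖mask τ θ‖ ^ 2 / 2 + ρ₀ / 2 * ‖θ - mask δ θ‖ ^ 2 := by
    rw [← ht2]; ring
  rw [e10]
  linarith

/-- Comparison of the masses of two Gaussians whose quadratic forms are close. -/
lemma gaussMass_le_exp_mul {ρ₀ κ c : ℝ} (hκ : 0 < κ) (hc : 0 ≤ c)
    {δ : Mdl p} {B B' : Vec p →L[ℝ] Vec p →L[ℝ] ℝ}
    (hB : ∀ θ, κ * ‖mask δ θ‖ ^ 2 ≤ B (mask δ θ) (mask δ θ))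
    (hBB' : ∀ θ, B' (mask δ θ) (mask δ θ) ≤ B (mask δ θ) (mask δ θ) + c * ‖mask δ θ‖ ^ 2) :
    gaussMass ρ₀ δ B ≤ ENNReal.ofReal (Real.exp (msize δ * c / (2 * κ))) * gaussMass ρ₀ δ B' := by
  -- By coercivity c‖·‖² ≤ (c/κ)B, so B' ≤ t²B, and rescaling by t costs t^d ≤ e^{dc/(2κ)}, where d
  -- is the model size.
  set t := √(1 + c / κ) with ht
  have hc' : 0 ≤ c / κ := by positivity
  have htpos : 0 < t := Real.sqrt_pos.mpr (by positivity)
  have ht2 : t ^ 2 = 1 + c / κ := Real.sq_sqrt (by positivity)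
  have hle : gaussMass ρ₀ δ (t ^ 2 • B) ≤ gaussMass ρ₀ δ B' := by
    refine gaussMass_anti fun θ => (hBB' θ).trans ?_
    simp only [ht2, smul_apply, smul_eq_mul]
    have h1 := mul_le_mul_of_nonneg_left (hB θ) hc'
    have h2 : c / κ * (κ * ‖mask δ θ‖ ^ 2) = c * ‖mask δ θ‖ ^ 2 := by field_simp
    linarith
  rw [gaussMass_sq_smul htpos] at hle
  have hpow : t ^ msize δ ≤ Real.exp (msize δ * c / (2 * κ)) := by
    have h1 : t ≤ Real.exp (c / (2 * κ)) := by
      rw [ht]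
      apply Real.sqrt_le_iff.mpr ⟨(Real.exp_pos _).le, ?_⟩
      rw [← Real.exp_nat_mul]
      have := Real.add_one_le_exp (c / κ)
      have h2 : ((2 : ℕ) : ℝ) * (c / (2 * κ)) = c / κ := by push_cast; field_simp
      rw [h2]; linarith
    calc t ^ msize δ ≤ Real.exp (c / (2 * κ)) ^ msize δ := by gcongr
      _ = _ := by rw [← Real.exp_nat_mul]; congr 1; ring
  calc gaussMass ρ₀ δ B
      = ENNReal.ofReal (t ^ msize δ) * (ENNReal.ofReal ((t ^ msize δ)⁻¹) * gaussMass ρ₀ δ B) := by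
        rw [← mul_assoc, ← ENNReal.ofReal_mul (by positivity), mul_inv_cancel₀ (by positivity)]
        simp
    _ ≤ _ := by gcongr

end Gaussian

/-! ### Taylor bounds for thrice differentiable functions -/

section Taylor

variable {E : Type*} [NormedAddCommGroup E] [NormedSpace ℝ E] {f : E → ℝ}

lemma hasDerivAt_iteratedFDeriv_line {k : ℕ} (hd : Differentiable ℝ (iteratedFDeriv ℝ k f))
    (x h : E) (m : Fin k → E) (t : ℝ) :
    HasDerivAt (fun t : ℝ => iteratedFDeriv ℝ k f (x + t • h) m)
      (iteratedFDeriv ℝ (k + 1) f (x + t • h) (Fin.cons h m)) t := by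
  have h1 : HasDerivAt (fun t : ℝ => x + t • h) h t := by
    simpa using ((hasDerivAt_id t).smul_const h).const_add x
  have h2 := (hd (x + t • h)).hasFDerivAt.comp_hasDerivAt t h1
  have h3 := (ContinuousMultilinearMap.apply ℝ (fun _ : Fin k => E) ℝ m).hasFDerivAt.comp_hasDerivAt
    t h2
  rw [iteratedFDeriv_succ_apply_left]
  exact h3

lemma abs_sub_le_of_hasDerivAt_of_abs_le {g g' : ℝ → ℝ} {M : ℝ}
    (hg : ∀ t, HasDerivAt g (g' t) t) (hM : ∀ t ∈ Set.Icc (0 : ℝ) 1, |g' t| ≤ M) :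
    ∀ t ∈ Set.Icc (0 : ℝ) 1, |g t - g 0| ≤ M := by
  intro t ht
  have h0 : 0 ≤ M := (abs_nonneg _).trans (hM 0 (by simp))
  have := norm_image_sub_le_of_norm_deriv_le_segment' (f := g) (f' := g') (C := M) (a := 0) (b := 1)
    (fun x _ => (hg x).hasDerivWithinAt) (fun x hx => hM x ⟨hx.1, hx.2.le⟩) t ht
  rw [Real.norm_eq_abs, sub_zero] at this
  nlinarith [ht.2]

/-- The mean value inequality is applied three times along the segment, each time after subtracting
a Taylor polynomial. The third derivative need only exist, at the price of M in place of M/6. -/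
lemma abs_taylor_two_le (hf : ∀ k < 3, Differentiable ℝ (iteratedFDeriv ℝ k f)) {x h : E} {M : ℝ}
    (hM : ∀ t ∈ Set.Icc (0 : ℝ) 1, |iteratedFDeriv ℝ 3 f (x + t • h) ![h, h, h]| ≤ M) :
    |f (x + h) - f x - fderiv ℝ f x h - iteratedFDeriv ℝ 2 f x ![h, h] / 2| ≤ M := by
  set g0 : ℝ → ℝ := fun t => iteratedFDeriv ℝ 0 f (x + t • h) ![]
  set g1 : ℝ → ℝ := fun t => iteratedFDeriv ℝ 1 f (x + t • h) ![h]
  set g2 : ℝ → ℝ := fun t => iteratedFDeriv ℝ 2 f (x + t • h) ![h, h]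
  have h0 : ∀ t, HasDerivAt g0 (g1 t) t :=
    hasDerivAt_iteratedFDeriv_line (hf 0 (by norm_num)) x h ![]
  have h1 : ∀ t, HasDerivAt g1 (g2 t) t :=
    hasDerivAt_iteratedFDeriv_line (hf 1 (by norm_num)) x h ![h]
  have h2 : ∀ t, HasDerivAt g2 (iteratedFDeriv ℝ 3 f (x + t • h) ![h, h, h]) t :=
    hasDerivAt_iteratedFDeriv_line (hf 2 (by norm_num)) x h ![h, h]
  have b2 := abs_sub_le_of_hasDerivAt_of_abs_le h2 hM
  have b1 := abs_sub_le_of_hasDerivAt_of_abs_le (g := fun t => g1 t - g2 0 * t)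
    (g' := fun t => g2 t - g2 0)
    (fun t => ((h1 t).fun_sub ((hasDerivAt_id' t).const_mul (g2 0))).congr_deriv (by simp)) b2
  have b0 := abs_sub_le_of_hasDerivAt_of_abs_le (g := fun t => g0 t - g1 0 * t - g2 0 / 2 * t ^ 2)
    (g' := fun t => g1 t - g1 0 - g2 0 * t)
    (fun t => (((h0 t).fun_sub ((hasDerivAt_id' t).const_mul (g1 0))).fun_sub
        ((hasDerivAt_pow 2 t).const_mul (g2 0 / 2))).congr_deriv (by simp; ring))
    (fun t ht => by
      have := b1 t ht
      simp only [mul_zero, sub_zero] at this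
      rwa [show g1 t - g1 0 - g2 0 * t = g1 t - g2 0 * t - g1 0 by ring]) 1 (by simp)
  have e0 : g0 0 = f x := by simp [g0]
  have e0' : g0 1 = f (x + h) := by simp [g0]
  have e1 : g1 0 = fderiv ℝ f x h := by simp [g1]
  have e2 : g2 0 = iteratedFDeriv ℝ 2 f x ![h, h] := by simp [g2]
  rw [← e0, ← e0', ← e1, ← e2]
  convert b0 using 2
  ring

lemma abs_iteratedFDeriv_two_sub_le (hf : Differentiable ℝ (iteratedFDeriv ℝ 2 f)) {x h v : E}
    {M : ℝ} (hM : ∀ t ∈ Set.Icc (0 : ℝ) 1, |iteratedFDeriv ℝ 3 f (x + t • h) ![h, v, v]| ≤ M) :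
    |iteratedFDeriv ℝ 2 f (x + h) ![v, v] - iteratedFDeriv ℝ 2 f x ![v, v]| ≤ M := by
  have h2 : ∀ t : ℝ, HasDerivAt (fun t : ℝ => iteratedFDeriv ℝ 2 f (x + t • h) ![v, v])
      (iteratedFDeriv ℝ 3 f (x + t • h) ![h, v, v]) t :=
    hasDerivAt_iteratedFDeriv_line hf x h ![v, v]
  simpa using abs_sub_le_of_hasDerivAt_of_abs_le h2 hM 1 (by simp)

end Taylor

/-! ### Bounds on Euclidean spaces -/

section Euclidean

lemma abs_linearMap_le_sqrt_card {ι : Type*} [Fintype ι] [DecidableEq ι]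
    (φ : EuclideanSpace ℝ ι →ₗ[ℝ] ℝ) {M : ℝ} (hM : 0 ≤ M)
    (h : ∀ i, |φ (EuclideanSpace.single i 1)| ≤ M) (a : EuclideanSpace ℝ ι) :
    |φ a| ≤ M * √(Fintype.card ι) * ‖a‖ := by
  have h1 : φ a = ∑ i, a i * φ (EuclideanSpace.single i 1) := by
    conv_lhs => rw [← (EuclideanSpace.basisFun ι ℝ).sum_repr a]
    simp
  have h2 : |φ a| ≤ M * ∑ i, |a i| := by
    rw [h1, Finset.mul_sum]
    refine (Finset.abs_sum_le_sum_abs _ _).trans (Finset.sum_le_sum fun i _ => ?_)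
    rw [abs_mul, mul_comm]
    gcongr
    exact h i
  have h3 : ∑ i, |a i| ≤ √(Fintype.card ι) * ‖a‖ := by
    refine le_of_sq_le_sq ?_ (by positivity)
    rw [mul_pow, Real.sq_sqrt (by positivity), EuclideanSpace.real_norm_sq_eq]
    simpa using sq_sum_le_card_mul_sum_sq (s := Finset.univ) (f := fun i => |a i|)
  calc |φ a| ≤ M * ∑ i, |a i| := h2
    _ ≤ M * (√(Fintype.card ι) * ‖a‖) := by gcongr
    _ = _ := by ring

/-- One slot at a time, passing from basis vectors to arbitrary vectors costs an ℓ¹–ℓ² factor √n.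
The three factors are the source of s̄^{3/2}. -/
lemma abs_trilinear_le {ι : Type*} [Fintype ι] [DecidableEq ι]
    (T : ContinuousMultilinearMap ℝ (fun _ : Fin 3 => EuclideanSpace ℝ ι) ℝ) {M : ℝ} (hM : 0 ≤ M)
    (h : ∀ i j k, |T ![EuclideanSpace.single i 1, EuclideanSpace.single j 1,
      EuclideanSpace.single k 1]| ≤ M) (a b c : EuclideanSpace ℝ ι) :
    |T ![a, b, c]| ≤ M * √(Fintype.card ι) ^ 3 * (‖a‖ * ‖b‖ * ‖c‖) := by
  set n := √(Fintype.card ι)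
  have u0 : ∀ a b c v : EuclideanSpace ℝ ι, Function.update ![a, b, c] 0 v = ![v, b, c] := by
    intro a b c v; ext i; fin_cases i <;> rfl
  have u1 : ∀ a b c v : EuclideanSpace ℝ ι, Function.update ![a, b, c] 1 v = ![a, v, c] := by
    intro a b c v; ext i; fin_cases i <;> rfl
  have u2 : ∀ a b c v : EuclideanSpace ℝ ι, Function.update ![a, b, c] 2 v = ![a, b, v] := by
    intro a b c v; ext i; fin_cases i <;> rfl
  have s1 : ∀ i j, |T ![EuclideanSpace.single i 1, EuclideanSpace.single j 1, c]|
      ≤ M * n * ‖c‖ := fun i j => by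
    have := abs_linearMap_le_sqrt_card (T.toMultilinearMap.toLinearMap
      ![EuclideanSpace.single i 1, EuclideanSpace.single j 1, 0] 2) hM
      (fun k => by simpa [u2] using h i j k) c
    simpa [u2] using this
  have s2 : ∀ i, |T ![EuclideanSpace.single i 1, b, c]| ≤ M * n * ‖c‖ * n * ‖b‖ := fun i => by
    have := abs_linearMap_le_sqrt_card (T.toMultilinearMap.toLinearMap
      ![EuclideanSpace.single i 1, 0, c] 1) (M := M * n * ‖c‖) (by positivity)
      (fun k => by simpa [u1] using s1 i k) b
    simpa [u1] using this
  have s3 := abs_linearMap_le_sqrt_card (T.toMultilinearMap.toLinearMap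
      ![0, b, c] 0) (M := M * n * ‖c‖ * n * ‖b‖) (by positivity)
      (fun k => by simpa [u0] using s2 k) a
  simp only [MultilinearMap.toLinearMap_apply, u0] at s3
  exact s3.trans_eq (by simp only [n]; ring)

variable {p : ℕ}

lemma abs_le_linf (θ : Vec p) (j : Fin p) : |θ j| ≤ linf θ :=
  le_ciSup (Set.finite_range fun j => |θ j|).bddAbove j

lemma abs_inner_le_linf {δ : Mdl p} {s : ℕ} (hs : msize δ ≤ s) (g : Vec p) {h : Vec p}
    (hh : mask δ h = h) (hg : 0 ≤ linf g) : |inner ℝ g h| ≤ linf g * √s * ‖h‖ := by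
  have h1 : inner ℝ g h = ∑ j ∈ Finset.univ.filter (fun j => δ j = true), g j * h j := by
    rw [Finset.sum_filter, PiLp.inner_apply]
    refine Finset.sum_congr rfl fun j _ => ?_
    by_cases hj : δ j = true
    · simp [hj, mul_comm]
    · have : h j = 0 := by rw [← hh]; simp [hj]
      simp [this]
  have h2 : |inner ℝ g h| ≤ linf g * ∑ j ∈ Finset.univ.filter (fun j => δ j = true), |h j| := by
    rw [h1, Finset.mul_sum]
    refine (Finset.abs_sum_le_sum_abs _ _).trans (Finset.sum_le_sum fun i _ => ?_)
    rw [abs_mul]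
    gcongr
    exact abs_le_linf g i
  have h3 : ∑ j ∈ Finset.univ.filter (fun j => δ j = true), |h j| ≤ √s * ‖h‖ := by
    refine le_of_sq_le_sq ?_ (by positivity)
    rw [mul_pow, Real.sq_sqrt (by positivity), EuclideanSpace.real_norm_sq_eq]
    refine sq_sum_le_card_mul_sum_sq.trans ?_
    simp only [sq_abs]
    gcongr
    · exact hs
    · exact Finset.filter_subset _ _
  calc _ ≤ _ := h2
    _ ≤ linf g * (√s * ‖h‖) := by gcongr
    _ = _ := by ring

end Euclidean

/-! ### Smoothness of the sub-model likelihoods -/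

section Likelihood

variable {p : ℕ} {Z : Type*} [MeasurableSpace Z] {ℓ : Vec p → Z → ℝ}

lemma IsQuasiLik.contDiff (hℓ : IsQuasiLik ℓ) (z : Z) : ContDiff ℝ 2 fun θ => ℓ θ z :=
  contDiff_of_differentiable_iteratedFDeriv (n := 2) fun m hm =>
    hℓ.diff z m (Nat.lt_succ_of_le (by exact_mod_cast hm))

lemma iteratedFDeriv_subLik (hℓ : IsQuasiLik ℓ) (δ : Mdl p) (z : Z) {k : ℕ} (hk : k ≤ 2)
    (u : SubVec δ) : iteratedFDeriv ℝ k (subLik ℓ δ z) u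
      = (iteratedFDeriv ℝ k (fun θ => ℓ θ z) (pad δ u)).compContinuousLinearMap
        fun _ => padCL δ :=
  (padCL δ).iteratedFDeriv_comp_right (hℓ.contDiff z) u (by exact_mod_cast hk)

/-- The likelihood is only C², so the chain rule for iterated derivatives stops at order two. The
third derivative comes from differentiating that formula once more. -/
lemma differentiable_iteratedFDeriv_subLik (hℓ : IsQuasiLik ℓ) (δ : Mdl p) (z : Z) :
    ∀ k < 3, Differentiable ℝ (iteratedFDeriv ℝ k (subLik ℓ δ z)) := by
  intro k hk
  rw [funext (iteratedFDeriv_subLik hℓ δ z (Nat.le_of_lt_succ hk))]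
  exact (ContinuousMultilinearMap.compContinuousLinearMapL
    fun _ : Fin k => padCL δ).differentiable.comp
      ((hℓ.diff z k hk).comp (padCL δ).differentiable)

/-- The negative Hessian of the quasi-likelihood as a bilinear form. -/
def negHess (ℓ : Vec p → Z → ℝ) (z : Z) (x : Vec p) : Vec p →L[ℝ] Vec p →L[ℝ] ℝ :=
  -fderiv ℝ (fderiv ℝ fun θ => ℓ θ z) x

lemma negHess_symm (hℓ : IsQuasiLik ℓ) (z : Z) (x v w : Vec p) :
    negHess ℓ z x v w = negHess ℓ z x w v := by
  have := ((hℓ.contDiff z).contDiffAt (x := x)).isSymmSndFDerivAt (by simp) v w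
  simp [negHess, this]

lemma iteratedFDeriv_two_subLik (hℓ : IsQuasiLik ℓ) (δ : Mdl p) (z : Z) (u v : SubVec δ) :
    iteratedFDeriv ℝ 2 (subLik ℓ δ z) u ![v, v]
      = -negHess ℓ z (pad δ u) (pad δ v) (pad δ v) := by
  rw [iteratedFDeriv_subLik hℓ δ z le_rfl]
  simp [negHess, iteratedFDeriv_two_apply]

lemma le_negHess_of_le_rayleigh (hℓ : IsQuasiLik ℓ) {δ : Mdl p} {z : Z} {u : SubVec δ} {κ : ℝ}
    (h : ∀ v : SubVec δ, v ≠ 0 → κ ≤ rayleigh ℓ δ z u v) (θ : Vec p) :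
    κ * ‖mask δ θ‖ ^ 2 ≤ negHess ℓ z (pad δ u) (mask δ θ) (mask δ θ) := by
  rw [← pad_sel]
  by_cases hv : sel δ θ = 0
  · have : pad δ (0 : SubVec δ) = 0 := map_zero (padCL δ)
    simp [hv, this]
  · have h1 := h _ hv
    have h2 : 0 < ‖sel δ θ‖ ^ 2 := by have := norm_pos_iff.mpr hv; positivity
    rwa [rayleigh, le_div_iff₀ h2, iteratedFDeriv_two_subLik hℓ, neg_neg, ← norm_pad] at h1

lemma continuous_subLik (hℓ : IsQuasiLik ℓ) (δ : Mdl p) (z : Z) : Continuous (subLik ℓ δ z) :=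
  (hℓ.contDiff z).continuous.comp (padCL δ).continuous

end Likelihood

/-! ### Maximisers -/

section Maximiser

variable {p : ℕ} {Z : Type*} {ℓ : Vec p → Z → ℝ} {z : Z}
  {δs : Mdl p} {θs : Vec p} {q ρ₀ ρ₁ ρbar κbar : ℝ} {r : ℝ → ℝ} {sbar : ℕ}

lemma mem_RpDelta_iff {δ : Mdl p} {θ : Vec p} : θ ∈ RpDelta δ ↔ mask δ θ = θ :=
  ⟨fun ⟨x, hx⟩ => by rw [← hx, mask_mask], fun h => ⟨θ, h⟩⟩

/-- At distance d > ε from θ⋆ the Bregman term is at most −r(d)/2 ≤ −√(s⋆+s̄) ρ̄ d, while the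
gradient term is at most (ρ̄/2)√s̄ d, which is strictly smaller in size. -/
lemma lik_lt_of_rate_lt (hρ : 0 < ρbar) (hsbar : 0 < sbar)
    (hne : (rateSet r (l0 θs) sbar ρbar).Nonempty)
    (hz : z ∈ E1 ℓ q ρ₀ ρ₁ δs θs ρbar κbar r sbar) {δ : Mdl p} (hδ : msize δ ≤ sbar)
    (hθs : mask δ θs = θs) {θ : Vec p} (hθ : mask δ θ = θ)
    (hlt : rate r (l0 θs) sbar ρbar < ‖θ - θs‖) : ℓ θ z < ℓ θs z := by
  obtain ⟨⟨-, hgrad, -⟩, hz1⟩ := hz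
  have h1 := hz1 δ hδ θ (mem_RpDelta_iff.mpr hθ)
  obtain ⟨y, hy, hyd⟩ := exists_lt_of_csInf_lt hne hlt
  have h2 := hy.2 _ hyd.le
  have hd : 0 < ‖θ - θs‖ := hy.1.trans hyd
  have hp : Nonempty (Fin p) := by
    by_contra hemp
    rw [not_nonempty_iff] at hemp
    simp [Subsingleton.elim θ θs] at hd
  set g := gradient (fun t => ℓ t z) θs
  have hg0 : 0 ≤ linf g := (abs_nonneg _).trans (abs_le_linf g hp.some)
  have h3 := abs_inner_le_linf hδ g (h := θ - θs) (by rw [mask_sub, hθ, hθs]) hg0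
  have h4 := le_of_abs_le h3
  rw [bregman] at h1
  have h5 : √(sbar : ℝ) ≤ √((l0 θs : ℝ) + sbar) := Real.sqrt_le_sqrt (by simp)
  have h6 : 0 < √(sbar : ℝ) := Real.sqrt_pos.mpr (by exact_mod_cast hsbar)
  have h7 : linf g * √sbar * ‖θ - θs‖ ≤ ρbar / 2 * √sbar * ‖θ - θs‖ := by gcongr
  have h8 : ρbar * ‖θ - θs‖ * √sbar ≤ ρbar * ‖θ - θs‖ * √((l0 θs : ℝ) + sbar) := by gcongr
  have h9 : 0 < ρbar * ‖θ - θs‖ * √sbar := by positivity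
  nlinarith

variable [MeasurableSpace Z]

/-- The likelihood has a maximiser on the sub-model, so that `mle` is one. -/
lemma subLik_le_mle (hℓ : IsQuasiLik ℓ) (hρ : 0 < ρbar) (hsbar : 0 < sbar)
    (hne : (rateSet r (l0 θs) sbar ρbar).Nonempty)
    (hz : z ∈ E1 ℓ q ρ₀ ρ₁ δs θs ρbar κbar r sbar) {δ : Mdl p} (hδ : msize δ ≤ sbar)
    (hθs : mask δ θs = θs) (v : SubVec δ) : subLik ℓ δ z v ≤ subLik ℓ δ z (mle ℓ δ z) := by
  have hex : ∃ u : SubVec δ, ∀ v, subLik ℓ δ z v ≤ subLik ℓ δ z u := by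
    -- Outside a ball about θ⋆ the likelihood is below its value at θ⋆, so compactness of the ball
    -- suffices.
    refine (continuous_subLik hℓ δ z).exists_forall_ge' (sel δ θs) ?_
    have h1 : ∀ᶠ v in cocompact (SubVec δ), rate r (l0 θs) sbar ρbar < dist v (sel δ θs) :=
      (tendsto_dist_right_cocompact_atTop (sel δ θs)).eventually_gt_atTop _
    filter_upwards [h1] with v hv
    have h2 : pad δ (sel δ θs) = θs := by rw [pad_sel, hθs]
    rw [subLik, subLik, h2]
    refine (lik_lt_of_rate_lt hρ hsbar hne hz hδ hθs (mask_pad δ v) ?_).le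
    rwa [dist_eq_norm, ← norm_pad, pad_sub, h2] at hv
  exact Classical.epsilon_spec hex v

lemma norm_pad_mle_sub_le (hℓ : IsQuasiLik ℓ) (hρ : 0 < ρbar) (hsbar : 0 < sbar)
    (hne : (rateSet r (l0 θs) sbar ρbar).Nonempty)
    (hz : z ∈ E1 ℓ q ρ₀ ρ₁ δs θs ρbar κbar r sbar) {δ : Mdl p} (hδ : msize δ ≤ sbar)
    (hθs : mask δ θs = θs) : ‖pad δ (mle ℓ δ z) - θs‖ ≤ rate r (l0 θs) sbar ρbar := by
  by_contra! h
  have h1 := lik_lt_of_rate_lt hρ hsbar hne hz hδ hθs (mask_pad δ _) h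
  have h2 := subLik_le_mle hℓ hρ hsbar hne hz hδ hθs (sel δ θs)
  rw [subLik, subLik, pad_sel, hθs] at h2
  exact h1.not_ge h2

end Maximiser

/-! ### Quadratic approximation of the likelihood -/

section Quadratic

variable {p : ℕ} {Z : Type*} {ℓ : Vec p → Z → ℝ} {z : Z}
  {δs : Mdl p} {sbar : ℕ} {C ε : ℝ}

lemma card_selected (δ : Mdl p) : Fintype.card {j : Fin p // δ j = true} = msize δ := by
  rw [Fintype.card_subtype, msize]

lemma abs_iteratedFDeriv_three_subLik_le (ha : a2 ℓ δs sbar C ε z ≠ ⊤) {δ : Mdl p}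
    (hδ : δ ∈ Aset δs sbar) {u : SubVec δ} (hu : ‖u - mle ℓ δ z‖ ≤ (C + 1) * ε)
    (a b c : SubVec δ) :
    |iteratedFDeriv ℝ 3 (subLik ℓ δ z) u ![a, b, c]|
      ≤ (a2 ℓ δs sbar C ε z).toReal * √sbar ^ 3 * (‖a‖ * ‖b‖ * ‖c‖) := by
  refine (abs_trilinear_le _ (ENNReal.toReal_nonneg (a := a2 ℓ δs sbar C ε z))
    (fun i j k => ?_) a b c).trans ?_
  · rw [← ENNReal.ofReal_le_iff_le_toReal ha, a2]
    refine le_trans ?_ (le_iSup₂ δ hδ)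
    rw [varpi]
    refine le_trans ?_ (le_iSup₂ u hu)
    exact le_iSup_of_le i (le_iSup_of_le j (le_iSup_of_le k le_rfl))
  · rw [card_selected]
    gcongr
    exact hδ.1

variable [MeasurableSpace Z]

/-- Second order expansion of the likelihood about the maximiser of the sub-model. -/
lemma abs_lik_sub_quadratic_le (hℓ : IsQuasiLik ℓ)
    (ha : a2 ℓ δs sbar C ε z ≠ ⊤) {δ : Mdl p} (hδ : δ ∈ Aset δs sbar)
    (hmax : ∀ v, subLik ℓ δ z v ≤ subLik ℓ δ z (mle ℓ δ z)) {θ : Vec p}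
    (hθ : ‖mask δ θ - pad δ (mle ℓ δ z)‖ ≤ (C + 1) * ε) :
    |ℓ (mask δ θ) z - ℓ (pad δ (mle ℓ δ z)) z
      + 1 / 2 * negHess ℓ z (pad δ (mle ℓ δ z)) (mask δ (θ - pad δ (mle ℓ δ z)))
        (mask δ (θ - pad δ (mle ℓ δ z)))|
      ≤ (a2 ℓ δs sbar C ε z).toReal * √sbar ^ 3 * ((C + 1) * ε) ^ 3 := by
  set m := mle ℓ δ z with hm
  set h := sel δ θ - m with hh
  have hpad : pad δ h = mask δ (θ - pad δ m) := by
    rw [hh, pad_sub, pad_sel, mask_sub, mask_pad]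
  have hnorm : ‖h‖ ≤ (C + 1) * ε := by
    rwa [← norm_pad, hpad, mask_sub, mask_pad]
  have hgrad : fderiv ℝ (subLik ℓ δ z) m = 0 :=
    IsLocalMax.fderiv_eq_zero (Eventually.of_forall hmax)
  have key := abs_taylor_two_le (differentiable_iteratedFDeriv_subLik hℓ δ z) (x := m) (h := h)
    (M := (a2 ℓ δs sbar C ε z).toReal * √sbar ^ 3 * ((C + 1) * ε) ^ 3) (fun t ht => by
      refine (abs_iteratedFDeriv_three_subLik_le ha hδ ?_ h h h).trans ?_
      · rw [add_sub_cancel_left, norm_smul, Real.norm_eq_abs, abs_of_nonneg ht.1]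
        exact (mul_le_of_le_one_left (norm_nonneg _) ht.2).trans hnorm
      · rw [show ‖h‖ * ‖h‖ * ‖h‖ = ‖h‖ ^ 3 by ring]
        gcongr)
  rw [hgrad, iteratedFDeriv_two_subLik hℓ, hpad, hh, add_sub_cancel, subLik, subLik, pad_sel]
    at key
  convert key using 2
  simp
  ring

/-- The Hessians at the maximisers of nested sub-models are close on the smaller one. -/
lemma negHess_le_negHess_add (hℓ : IsQuasiLik ℓ) (ha : a2 ℓ δs sbar C ε z ≠ ⊤) {δ : Mdl p}
    (hδ : δ ∈ Aset δs sbar) {x : Vec p} (hx : mask δ x = x) {d : ℝ} (hd : d ≤ (C + 1) * ε)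
    (hxd : ‖x - pad δ (mle ℓ δ z)‖ ≤ d) {v : Vec p} (hv : mask δ v = v) :
    negHess ℓ z x v v ≤ negHess ℓ z (pad δ (mle ℓ δ z)) v v
      + (a2 ℓ δs sbar C ε z).toReal * √sbar ^ 3 * d * ‖v‖ ^ 2 := by
  set m := mle ℓ δ z with hm
  set h := sel δ x - m with hh
  have hpad : pad δ h = x - pad δ m := by rw [hh, pad_sub, pad_sel, hx]
  have hnorm : ‖h‖ ≤ d := by rwa [← norm_pad, hpad]
  have hvn : ‖sel δ v‖ = ‖v‖ := by rw [← norm_pad, pad_sel, hv]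
  have key := abs_iteratedFDeriv_two_sub_le
    (differentiable_iteratedFDeriv_subLik hℓ δ z 2 (by norm_num)) (x := m) (h := h) (v := sel δ v)
    (M := (a2 ℓ δs sbar C ε z).toReal * √sbar ^ 3 * d * ‖v‖ ^ 2) (fun t ht => by
      refine (abs_iteratedFDeriv_three_subLik_le ha hδ ?_ h _ _).trans ?_
      · rw [add_sub_cancel_left, norm_smul, Real.norm_eq_abs, abs_of_nonneg ht.1]
        exact (mul_le_of_le_one_left (norm_nonneg _) ht.2).trans (hnorm.trans hd)
      · rw [hvn, mul_assoc, mul_assoc _ d, mul_assoc ‖h‖, ← sq]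
        rw [← mul_assoc]
        gcongr)
  rw [iteratedFDeriv_two_subLik hℓ, iteratedFDeriv_two_subLik hℓ, pad_sel, hv, hh, add_sub_cancel,
    pad_sel, hx] at key
  linarith [neg_le_of_abs_le key]

end Quadratic

/-! ### The quasi-posterior on a single model -/

section Section

variable {p : ℕ} {Z : Type*} {ℓ : Vec p → Z → ℝ} {z : Z} {q ρ₀ ρ₁ : ℝ}

/-- The unnormalised quasi-posterior mass of `{δ} × S`. -/
def sectionMass (ℓ : Vec p → Z → ℝ) (q ρ₀ ρ₁ : ℝ) (z : Z) (δ : Mdl p) (S : Set (Vec p)) : ℝ≥0∞ :=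
  ∫⁻ θ in S, ENNReal.ofReal (postDensity ℓ q ρ₀ ρ₁ z (δ, θ))

lemma postUnnorm_singleton_prod (δ : Mdl p) {S : Set (Vec p)} (hS : MeasurableSet S) :
    postUnnorm ℓ q ρ₀ ρ₁ z ({δ} ×ˢ S) = sectionMass ℓ q ρ₀ ρ₁ z δ S := by
  rw [postUnnorm, withDensity_apply _ ((measurableSet_singleton δ).prod hS),
    ← Measure.prod_restrict, Measure.restrict_singleton, Measure.count_singleton, one_smul,
    Measure.dirac_prod, (measurableEmbedding_prodMk_left δ).lintegral_map, sectionMass]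

/-- The normalising factor of the prior on the model `δ`. -/
def modelWeight (q ρ₀ ρ₁ : ℝ) (δ : Mdl p) : ℝ :=
  prior q δ * (ρ₁ / (2 * Real.pi)) ^ ((msize δ : ℝ) / 2)
    * (ρ₀ / (2 * Real.pi)) ^ (((p : ℝ) - (msize δ : ℝ)) / 2)

lemma postDensity_eq (δ : Mdl p) (θ : Vec p) :
    postDensity ℓ q ρ₀ ρ₁ z (δ, θ) = modelWeight q ρ₀ ρ₁ δ
      * Real.exp (ℓ (mask δ θ) z - ρ₁ / 2 * ‖mask δ θ‖ ^ 2 - ρ₀ / 2 * ‖θ - mask δ θ‖ ^ 2) := by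
  have : ℓ (mask δ θ) z - ρ₁ / 2 * ‖mask δ θ‖ ^ 2 - ρ₀ / 2 * ‖θ - mask δ θ‖ ^ 2
      = ℓ (mask δ θ) z + -(ρ₁ / 2) * ‖mask δ θ‖ ^ 2 + -(ρ₀ / 2) * ‖θ - mask δ θ‖ ^ 2 := by ring
  rw [this, Real.exp_add, Real.exp_add, postDensity, modelWeight]
  ring

lemma modelWeight_pos (hq : 0 < q) (hq1 : q < 1) (hρ₀ : 0 < ρ₀) (hρ₁ : 0 < ρ₁) (δ : Mdl p) :
    0 < modelWeight q ρ₀ ρ₁ δ := by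
  have : 0 < 1 - q := by linarith
  have := Real.pi_pos
  unfold modelWeight prior
  positivity

/-- The factors 2π cancel between spike and slab. The ρ₀ in √(ρ₁/ρ₀) is later cancelled by the
√(ρ₀/κ) of `gaussMass_le_of_contains`. -/
lemma modelWeight_eq (hq1 : q < 1) (hρ₀ : 0 < ρ₀) (hρ₁ : 0 < ρ₁) {δ δs : Mdl p} {m : ℕ}
    (hm : msize δ = msize δs + m) :
    modelWeight q ρ₀ ρ₁ δ
      = modelWeight q ρ₀ ρ₁ δs * ((q / (1 - q)) ^ m * √(ρ₁ / ρ₀) ^ m) := by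
  have hq' : 0 < 1 - q := by linarith
  have hpi := Real.pi_pos
  have hle : msize δs + m ≤ p := hm ▸ msize_le δ
  have half : ∀ a : ℝ, 0 < a → a ^ ((m : ℝ) / 2) = √a ^ m := fun a ha => by
    rw [Real.sqrt_eq_rpow, ← Real.rpow_natCast, ← Real.rpow_mul ha.le]; congr 1; ring
  set a := ρ₁ / (2 * Real.pi) with ha'
  set b := ρ₀ / (2 * Real.pi) with hb'
  have ha : 0 < a := by positivity
  have hb : 0 < b := by positivity
  have hab : √(ρ₁ / ρ₀) = √a / √b := by
    rw [← Real.sqrt_div ha.le]; congr 1; rw [ha', hb']; field_simp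
  have e1 : a ^ ((msize δ : ℝ) / 2) = a ^ ((msize δs : ℝ) / 2) * √a ^ m := by
    rw [← half a ha, ← Real.rpow_add ha, hm]; congr 1; push_cast; ring
  have e2 : b ^ (((p : ℝ) - msize δs) / 2) = b ^ (((p : ℝ) - msize δ) / 2) * √b ^ m := by
    rw [← half b hb, ← Real.rpow_add hb, hm]; congr 1; push_cast; ring
  have e3 : (1 - q) ^ (p - msize δs) = (1 - q) ^ (p - msize δ) * (1 - q) ^ m := by
    rw [← pow_add, hm]; congr 1; omega
  have hb2 : 0 < √b := Real.sqrt_pos.mpr hb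
  simp only [modelWeight, prior, ← ha', ← hb']
  rw [e1, e2, e3, hab, show q ^ msize δ = q ^ msize δs * q ^ m by rw [hm, pow_add]]
  rw [div_pow, div_pow]
  field_simp

lemma measurableSet_Bdelta (θs : Vec p) (ρ₀ C C₁ ε : ℝ) (δ : Mdl p) :
    MeasurableSet (Bdelta θs ρ₀ C C₁ ε δ) :=
  ((isClosed_le ((continuous_mask δ).sub continuous_const).norm continuous_const).inter
    (isClosed_le (continuous_id.sub (continuous_mask δ)).norm continuous_const)).measurableSet

/-- Upper bound for the mass of a model on a set where the log-likelihood is at most quadratic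
and the slab density bounded. -/
lemma sectionMass_le_gaussMass (hq : 0 < q) (hq1 : q < 1) (hρ₀ : 0 < ρ₀) (hρ₁ : 0 < ρ₁)
    {δ : Mdl p} {S : Set (Vec p)} (hS : MeasurableSet S) {B : Vec p →L[ℝ] Vec p →L[ℝ] ℝ}
    {x : Vec p} (hx : mask δ x = x) {a Q : ℝ}
    (hlik : ∀ θ ∈ S, ℓ (mask δ θ) z ≤ a - 1 / 2 * B (mask δ (θ - x)) (mask δ (θ - x)))
    (hpen : ∀ θ ∈ S, -(ρ₁ / 2 * ‖mask δ θ‖ ^ 2) ≤ Q) :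
    sectionMass ℓ q ρ₀ ρ₁ z δ S
      ≤ ENNReal.ofReal (modelWeight q ρ₀ ρ₁ δ * Real.exp (a + Q)) * gaussMass ρ₀ δ B := by
  have hW := modelWeight_pos hq hq1 hρ₀ hρ₁ δ
  rw [gaussMass, ← lintegral_sub_right_eq_self _ x,
    ← lintegral_const_mul' _ _ ENNReal.ofReal_ne_top]
  refine (setLIntegral_mono' hS fun θ hθ => ?_).trans (setLIntegral_le_lintegral _ _)
  rw [gaussDens, ← ENNReal.ofReal_mul (by positivity), postDensity_eq, mul_assoc, ← Real.exp_add]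
  refine ENNReal.ofReal_le_ofReal (mul_le_mul_of_nonneg_left (Real.exp_le_exp.mpr ?_) hW.le)
  -- The centre x lies in the sub-model, so translating by it leaves the spike coordinates
  -- unchanged.
  have h1 : θ - x - mask δ (θ - x) = θ - mask δ θ := by rw [mask_sub, hx]; abel
  rw [h1]
  linarith [hlik θ hθ, hpen θ hθ]

/-- Lower bound for the mass of a model where, near `x`, the log-likelihood is at least quadratic
and the slab density bounded below. -/
lemma gaussMass_le_sectionMass (hq : 0 < q) (hq1 : q < 1) (hρ₀ : 0 < ρ₀) (hρ₁ : 0 < ρ₁)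
    {δ : Mdl p} {B : Vec p →L[ℝ] Vec p →L[ℝ] ℝ} {κ R : ℝ} (hκ : 0 < κ)
    (hR : 2 * (√(msize δ : ℝ) + 1) ≤ R * √κ)
    (hB : ∀ θ, κ * ‖mask δ θ‖ ^ 2 ≤ B (mask δ θ) (mask δ θ))
    {x : Vec p} (hx : mask δ x = x) {a Q : ℝ}
    (hlik : ∀ θ, ‖mask δ (θ - x)‖ ≤ R →
      a - 1 / 2 * B (mask δ (θ - x)) (mask δ (θ - x)) ≤ ℓ (mask δ θ) z)
    (hpen : ∀ θ, ‖mask δ (θ - x)‖ ≤ R → Q ≤ -(ρ₁ / 2 * ‖mask δ θ‖ ^ 2)) :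
    ENNReal.ofReal (modelWeight q ρ₀ ρ₁ δ * Real.exp (a + Q)) * gaussMass ρ₀ δ B
      ≤ 2 * sectionMass ℓ q ρ₀ ρ₁ z δ Set.univ := by
  have hW := modelWeight_pos hq hq1 hρ₀ hρ₁ δ
  have hAm : MeasurableSet {θ : Vec p | ‖mask δ θ‖ ≤ R} :=
    (isClosed_le (continuous_mask δ).norm continuous_const).measurableSet
  refine (mul_le_mul_right (gaussMass_le_two_mul_setLIntegral hρ₀ hκ hR hB) _).trans ?_
  rw [mul_left_comm]
  refine mul_le_mul_right ?_ _
  rw [← lintegral_indicator hAm, ← lintegral_sub_right_eq_self _ x,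
    ← lintegral_const_mul' _ _ ENNReal.ofReal_ne_top, sectionMass, setLIntegral_univ]
  refine lintegral_mono fun θ => ?_
  by_cases hθ : ‖mask δ (θ - x)‖ ≤ R
  · rw [Set.indicator_of_mem (by exact hθ), gaussDens, ← ENNReal.ofReal_mul (by positivity),
      postDensity_eq, mul_assoc, ← Real.exp_add]
    refine ENNReal.ofReal_le_ofReal (mul_le_mul_of_nonneg_left (Real.exp_le_exp.mpr ?_) hW.le)
    have h1 : θ - x - mask δ (θ - x) = θ - mask δ θ := by rw [mask_sub, hx]; abel
    rw [h1]
    linarith [hlik θ hθ, hpen θ hθ]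
  · rw [Set.indicator_of_notMem (by exact hθ), mul_zero]
    exact zero_le

end Section

/-! ### Counting models -/

section Counting

variable {p : ℕ}

-- A model containing δ⋆ is determined by its set of extra coordinates, and C(p, m) ≤ p^m.
open Classical in
lemma card_contains_le (δs : Mdl p) (m : ℕ) :
    (Finset.univ.filter fun δ : Mdl p => contains δ δs ∧ msize δ = msize δs + m).card ≤ p ^ m := by
  have h1 : (Finset.univ.filter fun δ : Mdl p => contains δ δs ∧ msize δ = msize δs + m).card
      ≤ (Finset.powersetCard m (Finset.univ : Finset (Fin p))).card := by
    refine Finset.card_le_card_of_injOn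
      (fun δ => Finset.univ.filter fun j => mdiff δ δs j = true) (fun δ hδ => ?_) ?_
    · simp only [Finset.coe_filter, Finset.mem_univ, true_and, Set.mem_ofPred_eq] at hδ
      rw [Finset.mem_coe, Finset.mem_powersetCard]
      refine ⟨Finset.subset_univ _, ?_⟩
      have := msize_mdiff hδ.1
      rw [hδ.2, Nat.add_sub_cancel_left] at this
      exact this
    · intro δ hδ δ' hδ' h
      simp only [Finset.coe_filter, Finset.mem_univ, true_and, Set.mem_ofPred_eq] at hδ hδ'
      funext j
      have hj := congrArg (fun s => j ∈ s) h
      simp only [Finset.mem_filter, Finset.mem_univ, true_and, mdiff, Bool.and_eq_true,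
        Bool.not_eq_true', eq_iff_iff] at hj
      by_cases hs : δs j = true
      · rw [hδ.1 j hs, hδ'.1 j hs]
      · simp only [Bool.not_eq_true] at hs
        rw [Bool.eq_iff_iff]
        simpa [hs] using hj
  refine h1.trans ?_
  rw [Finset.card_powersetCard, Finset.card_univ, Fintype.card_fin]
  exact Nat.choose_le_pow p m

-- Grouping by the number m of extra coordinates, the count p^m cancels p^{-m}. What remains is a
-- geometric tail of ratio at most 1/2, whence the factor 2.
open Classical in
lemma sum_contains_pow_le (hp : 0 < p) (δs : Mdl p) (j : ℕ) {x : ℝ} (hx0 : 0 ≤ x)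
    (hx : x ≤ 1 / 2) :
    ∑ δ ∈ Finset.univ.filter (fun δ : Mdl p => contains δ δs ∧ msize δs + j < msize δ),
      (x / p) ^ (msize δ - msize δs) ≤ 2 * x ^ (j + 1) := by
  set F := Finset.univ.filter (fun δ : Mdl p => contains δ δs ∧ msize δs + j < msize δ)
  have hp' : (0 : ℝ) < p := by exact_mod_cast hp
  have hmaps : ∀ δ ∈ F, msize δ - msize δs ∈ Finset.Ico (j + 1) (p + 1) := fun δ hδ => by
    simp only [F, Finset.mem_filter, Finset.mem_univ, true_and] at hδ
    have := msize_le δ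
    rw [Finset.mem_Ico]
    omega
  rw [← Finset.sum_fiberwise_of_maps_to hmaps]
  calc ∑ m ∈ Finset.Ico (j + 1) (p + 1),
        ∑ δ ∈ F with msize δ - msize δs = m, (x / p) ^ (msize δ - msize δs)
      ≤ ∑ m ∈ Finset.Ico (j + 1) (p + 1), x ^ m := by
        refine Finset.sum_le_sum fun m _ => ?_
        have h1 : ∑ δ ∈ F with msize δ - msize δs = m, (x / p) ^ (msize δ - msize δs)
            = ((F.filter fun δ => msize δ - msize δs = m).card : ℝ) * (x / p) ^ m := by
          rw [← nsmul_eq_mul, ← Finset.sum_const]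
          refine Finset.sum_congr rfl fun δ hδ => ?_
          rw [(Finset.mem_filter.mp hδ).2]
        have h2 : (F.filter fun δ => msize δ - msize δs = m).card ≤ p ^ m := by
          refine le_trans (Finset.card_le_card fun δ hδ => ?_) (card_contains_le δs m)
          simp only [F, Finset.mem_filter, Finset.mem_univ, true_and] at hδ ⊢
          exact ⟨hδ.1.1, by omega⟩
        have h3 : ((F.filter fun δ => msize δ - msize δs = m).card : ℝ) ≤ (p : ℝ) ^ m := by
          exact_mod_cast h2
        rw [h1]
        calc _ ≤ (p : ℝ) ^ m * (x / p) ^ m := by gcongr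
          _ = x ^ m := by rw [← mul_pow]; congr 1; field_simp
    _ ≤ x ^ (j + 1) / (1 - x) := geom_sum_Ico_le_of_lt_one hx0 (by linarith)
    _ ≤ 2 * x ^ (j + 1) := by
        rw [div_le_iff₀ (by linarith)]
        nlinarith [pow_nonneg hx0 (j + 1)]

end Counting

/-! ### Comparison of a model with the true one -/

section Comparison

variable {p : ℕ} {Z : Type*} {ℓ : Vec p → Z → ℝ} {z : Z}
  {δs : Mdl p} {θs : Vec p} {q u ρ₀ ρ₁ ρbar κbar κ C C₁ ε : ℝ} {r : ℝ → ℝ} {sbar : ℕ}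

/-- The factor of `selBound` that does not depend on the number of spurious coordinates. -/
def laplaceFactor (C ρ₁ : ℝ) (θs : Vec p) (sbar : ℕ) (ε A κ : ℝ) : ℝ :=
  Real.exp (2 * (C + 1) ^ 3
      * (ρ₁ * linf θs * √(sbar : ℝ) * ε + A * ((sbar : ℝ) ^ (3 / 2 : ℝ) * ε ^ 3)))
    * Real.exp (A * (2 * (sbar : ℝ) ^ 3 * ε / κ))

lemma sqrt_pow_three (x : ℝ) (hx : 0 ≤ x) : √x ^ 3 = x ^ (3 / 2 : ℝ) := by
  rw [Real.sqrt_eq_rpow, ← Real.rpow_natCast, ← Real.rpow_mul hx]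
  norm_num

/-- The exponent collects two Taylor remainders, three units of slab error (one from the upper
bound, two from the lower), and the cost of comparing the Hessians. For the last, s̄ ≥ 1 gives √s̄³
≤ s̄². -/
lemma exp_errors_le_laplaceFactor {A l s : ℝ} (hC : 3 ≤ C) (hρ₁ : 0 < ρ₁) (hl : 0 ≤ l)
    (hl' : l = linf θs) (hε : 0 < ε) (hκ : 0 < κ) (hA : 0 ≤ A) (hs : s ≤ sbar)
    (hsbar : 1 ≤ sbar) :
    Real.exp (2 * (A * √sbar ^ 3 * ((C + 1) * ε) ^ 3) + 3 * (ρ₁ * (l * √sbar * (C * ε)))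
        + s * (A * √sbar ^ 3 * (2 * ε)) / (2 * κ))
      ≤ laplaceFactor C ρ₁ θs sbar ε A κ := by
  have hsb : (1 : ℝ) ≤ sbar := by exact_mod_cast hsbar
  rw [laplaceFactor, ← Real.exp_add, ← hl', ← sqrt_pow_three _ (by positivity)]
  refine Real.exp_le_exp.mpr (add_le_add ?_ ?_)
  · have h1 : 0 ≤ ρ₁ * l * √sbar * ε := by positivity
    have h2 : 3 * C ≤ 2 * (C + 1) ^ 3 := by
      nlinarith [sq_nonneg C, mul_nonneg (sq_nonneg C) (by linarith : 0 ≤ C)]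
    nlinarith [mul_le_mul_of_nonneg_right h2 h1]
  · have h1 : √(sbar : ℝ) ≤ sbar := by
      rw [Real.sqrt_le_left (by positivity)]; nlinarith
    have h2 : √(sbar : ℝ) ^ 3 ≤ (sbar : ℝ) ^ 2 := by
      have := Real.sq_sqrt (by positivity : (0 : ℝ) ≤ sbar)
      calc √(sbar : ℝ) ^ 3 = √(sbar : ℝ) ^ 2 * √(sbar : ℝ) := by ring
        _ ≤ (sbar : ℝ) * sbar := by rw [this]; gcongr
        _ = _ := by ring
    calc s * (A * √sbar ^ 3 * (2 * ε)) / (2 * κ)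
        ≤ (sbar : ℝ) * (A * (sbar : ℝ) ^ 2 * (2 * ε)) / (2 * κ) := by gcongr
      _ = A * ((sbar : ℝ) ^ 3 * ε / κ) := by field_simp
      _ ≤ A * (2 * (sbar : ℝ) ^ 3 * ε / κ) := by
        gcongr
        nlinarith [pow_pos (by linarith : (0 : ℝ) < sbar) 3]

/-- The likelihood gain consumes p^{u/2} of the prior's p^{u+1} per coordinate. Of the rest,
p^{-u/2} survives in the bound and 1/p pays for counting models. -/
lemma model_factor_le (h2 : H2 p q u ρ₁) (hρ₀ : 0 < ρ₀) (hρ₁ : 0 < ρ₁) (hκ : 0 < κ) {m : ℕ}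
    {a b : ℝ} (hab : a - b ≤ m * u / 2 * Real.log p) :
    (q / (1 - q)) ^ m * √(ρ₁ / ρ₀) ^ m * √(ρ₀ / κ) ^ m * Real.exp (a - b)
      ≤ (√(ρ₁ / κ) * (1 / (p : ℝ) ^ (u / 2)) / p) ^ m := by
  have hp : (0 : ℝ) < p := by have := h2.p_ge; positivity
  have h3 : Real.exp (a - b) ≤ ((p : ℝ) ^ (u / 2)) ^ m := by
    rw [Real.rpow_def_of_pos hp, ← Real.exp_nat_mul]
    refine Real.exp_le_exp.mpr (hab.trans_eq ?_)
    ring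
  have h4 : √(ρ₁ / ρ₀) * √(ρ₀ / κ) = √(ρ₁ / κ) := by
    rw [← Real.sqrt_mul (by positivity)]; congr 1; field_simp
  have h5 : (p : ℝ) ^ (u + 1) = (p : ℝ) ^ (u / 2) * (p : ℝ) ^ (u / 2) * p := by
    rw [← Real.rpow_add hp, ← Real.rpow_add_one hp.ne']; congr 1; ring
  rw [h2.q_eq]
  calc _ ≤ (1 / (p : ℝ) ^ (u + 1)) ^ m * √(ρ₁ / ρ₀) ^ m * √(ρ₀ / κ) ^ m
          * ((p : ℝ) ^ (u / 2)) ^ m := by gcongr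
    _ = (1 / (p : ℝ) ^ (u + 1) * (√(ρ₁ / ρ₀) * √(ρ₀ / κ)) * (p : ℝ) ^ (u / 2)) ^ m := by
        rw [mul_pow, mul_pow, mul_pow]; ring
    _ = _ := by
        congr 1
        have := Real.rpow_pos_of_pos hp (u / 2)
        rw [h4, h5]
        field_simp

variable [MeasurableSpace Z]

/-- The Laplace comparison of one overfitted model with δ⋆. The true model's mass is taken over all
of ℝ^p, so that after normalisation it is at most 1. -/
lemma sectionMass_Bdelta_le (hℓ : IsQuasiLik ℓ) (hC : 3 ≤ C) (hρ₀ : 0 < ρ₀) (hρ₁ : 0 < ρ₁)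
    (h2 : H2 p q u ρ₁) (hρbar : 0 < ρbar) (hθs : mask δs θs = θs) (hl0 : l0 θs = msize δs)
    (hs : 0 < msize δs) (hsbar : msize δs ≤ sbar) (hsig : StrongSignal δs θs r sbar ρbar C)
    (hε : ε = rate r (l0 θs) sbar ρbar) (hε0 : 0 < ε)
    (hz : z ∈ E2 ℓ q ρ₀ ρ₁ u δs θs ρbar κbar r sbar) (hκ : 0 < κ)
    (hlow : ∀ δ ∈ Aset δs sbar, ∀ v : SubVec δ, v ≠ 0 → κ ≤ rayleigh ℓ δ z (mle ℓ δ z) v)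
    (hdim : 2 * (√(l0 θs : ℝ) + 1) ≤ (C - 1) * ε * √κ)
    (ha : a2 ℓ δs sbar C ε z ≠ ⊤) {δ : Mdl p} (hδ : δ ∈ Aset δs sbar) {m : ℕ}
    (hm : msize δ = msize δs + m) (hm1 : 1 ≤ m) :
    sectionMass ℓ q ρ₀ ρ₁ z δ (Bdelta θs ρ₀ C C₁ ε δ)
      ≤ ENNReal.ofReal (laplaceFactor C ρ₁ θs sbar ε (a2 ℓ δs sbar C ε z).toReal κ
          * (√(ρ₁ / κ) * (1 / (p : ℝ) ^ (u / 2)) / p) ^ m)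
        * (2 * sectionMass ℓ q ρ₀ ρ₁ z δs Set.univ) := by
  have hsb : 0 < sbar := hs.trans_le hsbar
  have hsb1 : (1 : ℝ) ≤ sbar := by exact_mod_cast hsb
  have hδs : δs ∈ Aset δs sbar := ⟨hsbar, fun _ h => h⟩
  have hδθ : mask δ θs = θs := by
    conv_lhs => rw [← hθs]
    rw [mask_mask_of_contains hδ.2, hθs]
  obtain ⟨hz1, hz2⟩ := hz
  set A := (a2 ℓ δs sbar C ε z).toReal
  have hA : 0 ≤ A := ENNReal.toReal_nonneg
  obtain ⟨j₀, hj₀⟩ := Finset.card_pos.mp hs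
  simp only [Finset.mem_filter, Finset.mem_univ, true_and] at hj₀
  -- The strong signal lets the quadratic slab error (Cε)² be absorbed into ‖θ⋆‖_∞ √s̄ Cε.
  have hlinf : C * ε ≤ linf θs := (hε ▸ (hsig.lt j₀ hj₀).le).trans (abs_le_linf θs j₀)
  have hCε : 0 < C * ε := by positivity
  set l := linf θs with hl
  have hl0' : 0 ≤ l := hCε.le.trans hlinf
  have htri : ∀ a b c : Vec p, ‖a - b‖ ≤ ‖a - c‖ + ‖b - c‖ := fun a b c => by
    rw [norm_sub_rev b c]
    exact norm_sub_le_norm_sub_add_norm_sub a c b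
  set x := pad δ (mle ℓ δ z) with hx
  set xs := pad δs (mle ℓ δs z) with hxs
  have hmx : mask δ x = x := mask_pad _ _
  have hmxs : mask δs xs = xs := mask_pad _ _
  have hxθ : ‖x - θs‖ ≤ ε := hε ▸ norm_pad_mle_sub_le hℓ hρbar hsb hsig.finite hz1 hδ.1 hδθ
  have hxsθ : ‖xs - θs‖ ≤ ε := hε ▸ norm_pad_mle_sub_le hℓ hρbar hsb hsig.finite hz1 hsbar hθs
  have hmax := subLik_le_mle hℓ hρbar hsb hsig.finite hz1 hδ.1 hδθ
  have hmaxs := subLik_le_mle hℓ hρbar hsb hsig.finite hz1 hsbar hθs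
  have hH := le_negHess_of_le_rayleigh hℓ (hlow δ hδ)
  have hHs := le_negHess_of_le_rayleigh hℓ (hlow δs hδs)
  rw [← hx] at hH
  rw [← hxs] at hHs
  set R := A * √sbar ^ 3 * ((C + 1) * ε) ^ 3 with hR
  set P := ρ₁ * (l * √sbar * (C * ε)) with hP
  set n₀ := ρ₁ / 2 * ‖θs‖ ^ 2 with hn₀
  -- The upper bound needs only the cross term, since −‖h‖² can be dropped. The lower bound pays for
  -- both, at most P + P/2 ≤ 2P.
  have hpen : ∀ {δ' : Mdl p}, msize δ' ≤ sbar → mask δ' θs = θs → ∀ θ,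
      ‖mask δ' θ - θs‖ ≤ C * ε →
        -(ρ₁ / 2 * ‖mask δ' θ‖ ^ 2) ≤ P - n₀ ∧ -n₀ - 2 * P ≤ -(ρ₁ / 2 * ‖mask δ' θ‖ ^ 2) := by
    intro δ' hδ' hθ' θ hθ
    set h := mask δ' θ - θs with hh
    have e1 : mask δ' θ = θs + h := by rw [hh]; abel
    have e2 : |inner ℝ θs h| ≤ l * √sbar * (C * ε) :=
      (abs_inner_le_linf hδ' θs (by rw [hh, mask_sub, mask_mask, hθ']) hl0').trans (by gcongr)
    have e3 := abs_le.mp e2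
    have e4 : ‖h‖ ^ 2 ≤ l * √sbar * (C * ε) := by
      have e5 : (1 : ℝ) ≤ √sbar := Real.one_le_sqrt.mpr hsb1
      calc ‖h‖ ^ 2 ≤ (C * ε) ^ 2 := by gcongr
        _ = C * ε * 1 * (C * ε) := by ring
        _ ≤ l * √sbar * (C * ε) := by gcongr
    rw [e1, norm_add_sq_real, hP, hn₀]
    constructor
    · nlinarith [mul_le_mul_of_nonneg_left e3.1 hρ₁.le, mul_nonneg hρ₁.le (sq_nonneg ‖h‖)]
    · nlinarith [mul_le_mul_of_nonneg_left e3.2 hρ₁.le, mul_le_mul_of_nonneg_left e4 hρ₁.le,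
        mul_nonneg hρ₁.le ((sq_nonneg ‖h‖).trans e4)]
  have hupper : sectionMass ℓ q ρ₀ ρ₁ z δ (Bdelta θs ρ₀ C C₁ ε δ)
      ≤ ENNReal.ofReal (modelWeight q ρ₀ ρ₁ δ * Real.exp (ℓ x z + R + (P - n₀)))
        * gaussMass ρ₀ δ (negHess ℓ z x) := by
    refine sectionMass_le_gaussMass h2.q_pos h2.q_lt hρ₀ hρ₁ (measurableSet_Bdelta _ _ _ _ _ _) hmx
      (fun θ hθ => ?_) fun θ hθ => (hpen hδ.1 hδθ θ hθ.1).1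
    have hball : ‖mask δ θ - x‖ ≤ (C + 1) * ε := by
      calc ‖mask δ θ - x‖ ≤ ‖mask δ θ - θs‖ + ‖x - θs‖ := htri _ _ _
        _ ≤ C * ε + ε := add_le_add hθ.1 hxθ
        _ = _ := by ring
    have := le_of_abs_le (abs_lik_sub_quadratic_le hℓ ha hδ hmax hball)
    rw [← hx] at this
    linarith
  have hlower : ENNReal.ofReal (modelWeight q ρ₀ ρ₁ δs
        * Real.exp (ℓ xs z - R + (-n₀ - 2 * P))) * gaussMass ρ₀ δs (negHess ℓ z xs)
      ≤ 2 * sectionMass ℓ q ρ₀ ρ₁ z δs Set.univ := by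
    -- Radius (C − 1)ε about the maximiser, itself within ε of θ⋆, stays within Cε of θ⋆, where
    -- `hpen` applies.
    refine gaussMass_le_sectionMass h2.q_pos h2.q_lt hρ₀ hρ₁ hκ (hl0 ▸ hdim) hHs hmxs
      (fun θ hθ => ?_) fun θ hθ => (hpen hsbar hθs θ ?_).2
    · have hball : ‖mask δs θ - xs‖ ≤ (C + 1) * ε := by
        rw [mask_sub, hmxs] at hθ
        exact hθ.trans (by nlinarith)
      have := neg_le_of_abs_le (abs_lik_sub_quadratic_le hℓ ha hδs hmaxs hball)
      rw [← hxs] at this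
      linarith
    · rw [mask_sub, hmxs] at hθ
      calc ‖mask δs θ - θs‖ ≤ ‖mask δs θ - xs‖ + ‖xs - θs‖ :=
          norm_sub_le_norm_sub_add_norm_sub _ _ _
        _ ≤ (C - 1) * ε + ε := add_le_add hθ hxsθ
        _ = _ := by ring
  have hschur := gaussMass_le_of_contains hρ₀ hκ hδ.2 (negHess_symm hℓ z x) hH
  -- Both maximisers are within ε of θ⋆, hence within 2ε of each other.
  have hcomp : gaussMass ρ₀ δs (negHess ℓ z x)
      ≤ ENNReal.ofReal (Real.exp (msize δs * (A * √sbar ^ 3 * (2 * ε)) / (2 * κ)))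
        * gaussMass ρ₀ δs (negHess ℓ z xs) := by
    refine gaussMass_le_exp_mul hκ (by positivity) (fun θ => ?_) fun θ => ?_
    · have := hH (mask δs θ)
      rwa [mask_mask_of_contains hδ.2] at this
    · refine negHess_le_negHess_add hℓ ha hδ ?_ (by nlinarith) ?_ (mask_mask_of_contains hδ.2 θ)
      · conv_lhs => rw [← hmxs]
        rw [mask_mask_of_contains hδ.2, hmxs]
      · calc ‖xs - x‖ ≤ ‖xs - θs‖ + ‖x - θs‖ := htri _ _ _
          _ ≤ 2 * ε := by linarith
  have hgap : ℓ x z - ℓ xs z ≤ m * u / 2 * Real.log p :=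
    hz2 m hm1 (by rw [hl0]; have := hδ.1; omega) δ hδ (by rw [hl0, hm])
  rw [hm, Nat.add_sub_cancel_left] at hschur
  have hWs := modelWeight_pos h2.q_pos h2.q_lt hρ₀ hρ₁ δs
  have hq1 : 0 < 1 - q := by linarith [h2.q_lt]
  have hq0 := h2.q_pos
  set e := (msize δs : ℝ) * (A * √sbar ^ 3 * (2 * ε)) / (2 * κ) with he
  have hfac : modelWeight q ρ₀ ρ₁ δ * Real.exp (ℓ x z + R + (P - n₀))
        * (√(ρ₀ / κ) ^ m * Real.exp e)
      ≤ laplaceFactor C ρ₁ θs sbar ε A κ * (√(ρ₁ / κ) * (1 / (p : ℝ) ^ (u / 2)) / p) ^ m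
        * (modelWeight q ρ₀ ρ₁ δs * Real.exp (ℓ xs z - R + (-n₀ - 2 * P))) := by
    have f1 := model_factor_le h2 hρ₀ hρ₁ hκ hgap
    have f2 := exp_errors_le_laplaceFactor (θs := θs) (s := msize δs) hC hρ₁ hl0' hl hε0 hκ hA
      (by exact_mod_cast hsbar) hsb
    rw [modelWeight_eq h2.q_lt hρ₀ hρ₁ hm]
    have f3 : Real.exp (ℓ x z + R + (P - n₀)) * Real.exp e
        = Real.exp (ℓ x z - ℓ xs z) * Real.exp (2 * R + 3 * P + e)
          * Real.exp (ℓ xs z - R + (-n₀ - 2 * P)) := by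
      rw [← Real.exp_add, ← Real.exp_add, ← Real.exp_add]; congr 1; ring
    calc _ = ((q / (1 - q)) ^ m * √(ρ₁ / ρ₀) ^ m * √(ρ₀ / κ) ^ m * Real.exp (ℓ x z - ℓ xs z))
          * Real.exp (2 * R + 3 * P + e)
          * (modelWeight q ρ₀ ρ₁ δs * Real.exp (ℓ xs z - R + (-n₀ - 2 * P))) := by
          linear_combination (modelWeight q ρ₀ ρ₁ δs * ((q / (1 - q)) ^ m * √(ρ₁ / ρ₀) ^ m)
            * √(ρ₀ / κ) ^ m) * f3
      _ ≤ (√(ρ₁ / κ) * (1 / (p : ℝ) ^ (u / 2)) / p) ^ m * laplaceFactor C ρ₁ θs sbar ε A κ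
          * (modelWeight q ρ₀ ρ₁ δs * Real.exp (ℓ xs z - R + (-n₀ - 2 * P))) := by gcongr
      _ = _ := by ring
  have hW := modelWeight_pos h2.q_pos h2.q_lt hρ₀ hρ₁ δ
  have hLpos : 0 ≤ laplaceFactor C ρ₁ θs sbar ε A κ := by unfold laplaceFactor; positivity
  calc _ ≤ ENNReal.ofReal (modelWeight q ρ₀ ρ₁ δ * Real.exp (ℓ x z + R + (P - n₀)))
        * (ENNReal.ofReal (√(ρ₀ / κ) ^ m) * (ENNReal.ofReal (Real.exp e)
          * gaussMass ρ₀ δs (negHess ℓ z xs))) :=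
        hupper.trans (mul_le_mul_right (hschur.trans (mul_le_mul_right hcomp _)) _)
    _ = ENNReal.ofReal (modelWeight q ρ₀ ρ₁ δ * Real.exp (ℓ x z + R + (P - n₀))
        * (√(ρ₀ / κ) ^ m * Real.exp e)) * gaussMass ρ₀ δs (negHess ℓ z xs) := by
        rw [ENNReal.ofReal_mul (q := √(ρ₀ / κ) ^ m * Real.exp e) (by positivity),
          ENNReal.ofReal_mul (p := √(ρ₀ / κ) ^ m) (by positivity)]
        ring
    _ ≤ ENNReal.ofReal (laplaceFactor C ρ₁ θs sbar ε A κ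
          * (√(ρ₁ / κ) * (1 / (p : ℝ) ^ (u / 2)) / p) ^ m
        * (modelWeight q ρ₀ ρ₁ δs * Real.exp (ℓ xs z - R + (-n₀ - 2 * P))))
          * gaussMass ρ₀ δs (negHess ℓ z xs) :=
        mul_le_mul_left (ENNReal.ofReal_le_ofReal hfac) _
    _ = ENNReal.ofReal (laplaceFactor C ρ₁ θs sbar ε A κ
          * (√(ρ₁ / κ) * (1 / (p : ℝ) ^ (u / 2)) / p) ^ m)
        * (ENNReal.ofReal (modelWeight q ρ₀ ρ₁ δs * Real.exp (ℓ xs z - R + (-n₀ - 2 * P)))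
          * gaussMass ρ₀ δs (negHess ℓ z xs)) := by
        rw [ENNReal.ofReal_mul (by positivity), mul_assoc]
    _ ≤ _ := mul_le_mul_right hlower _

end Comparison

/-! ### The bound on the quasi-posterior -/

section Posterior

variable {p : ℕ} {Z : Type*} {ℓ : Vec p → Z → ℝ} {z : Z}
  {δs : Mdl p} {θs : Vec p} {q u ρ₀ ρ₁ ρbar κbar κ C C₁ ε : ℝ} {r : ℝ → ℝ} {sbar : ℕ}

lemma post_univ (hwd : PostWellDefined ℓ q ρ₀ ρ₁ z) : post ℓ q ρ₀ ρ₁ z Set.univ = 1 :=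
  ENNReal.inv_mul_cancel hwd.1 hwd.2

/-- When 𝖺₂ = ∞ the claim is trivial. Positivity of every coefficient prevents a product 0 · ∞ = 0.
-/
lemma selBound_top {C₀ : ℝ} (hC₀ : 0 < C₀) (hρ₁ : 0 < ρ₁) (hε : 0 < ε) (hκ : 0 < κ) (hp : 0 < p)
    (hsbar : 0 < sbar) (j : ℕ) : selBound C₀ ρ₁ θs sbar ε ⊤ κ u j = ⊤ := by
  have hsb : (0 : ℝ) < sbar := by exact_mod_cast hsbar
  have hp' : (0 : ℝ) < p := by exact_mod_cast hp
  have h1 : (0 : ℝ) < (sbar : ℝ) ^ (3 / 2 : ℝ) * ε ^ 3 := by positivity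
  have h2 : (0 : ℝ) < 2 * (sbar : ℝ) ^ 3 * ε / κ := by positivity
  have h3 : (0 : ℝ) < (√(ρ₁ / κ) * (1 / (p : ℝ) ^ (u / 2))) ^ (j + 1) := by positivity
  rw [selBound, EReal.coe_ennreal_top, EReal.top_mul_coe_of_pos h1, EReal.top_mul_coe_of_pos h2,
    EReal.coe_add_top, EReal.coe_mul_top_of_pos hC₀, EReal.exp_top,
    ENNReal.mul_top (by norm_num), ENNReal.top_mul (ENNReal.ofReal_pos.mpr h3).ne']

lemma selBound_eq (hA : a2 ℓ δs sbar C ε z ≠ ⊤) (j : ℕ) :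
    selBound (2 * (C + 1) ^ 3) ρ₁ θs sbar ε (a2 ℓ δs sbar C ε z) κ u j
      = ENNReal.ofReal (8 * laplaceFactor C ρ₁ θs sbar ε (a2 ℓ δs sbar C ε z).toReal κ
        * (√(ρ₁ / κ) * (1 / (p : ℝ) ^ (u / 2))) ^ (j + 1)) := by
  rw [selBound, ← EReal.coe_ennreal_toReal hA, ← EReal.coe_mul, ← EReal.coe_mul, ← EReal.coe_add,
    ← EReal.coe_mul, EReal.exp_coe, EReal.exp_coe, laplaceFactor,
    ENNReal.ofReal_mul (by positivity), ENNReal.ofReal_mul (by norm_num),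
    ENNReal.ofReal_mul (by positivity)]
  norm_num [mul_assoc]

lemma l0_eq_msize (hθs : mask δs θs = θs) (hne : ∀ j, δs j = true → θs j ≠ 0) :
    l0 θs = msize δs := by
  rw [l0, msize]
  congr 1
  ext j
  simp only [Finset.mem_filter, Finset.mem_univ, true_and]
  refine ⟨fun h => ?_, hne j⟩
  by_contra hj
  exact h (by rw [← hθs]; simp [hj])

/-- Omitting a true coordinate j leaves an error of at least |θ⋆_j| > Cε in that coordinate alone.
-/
lemma contains_of_mem_Bdelta {δ : Mdl p} {θ : Vec p}
    (hsig : ∀ j, δs j = true → C * ε < |θs j|) (hθ : θ ∈ Bdelta θs ρ₀ C C₁ ε δ) :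
    contains δ δs := by
  intro j hj
  by_contra h
  have h1 := PiLp.norm_apply_le (mask δ θ - θs) j
  have h2 : (mask δ θ - θs) j = -θs j := by simp [h]
  rw [h2, norm_neg, Real.norm_eq_abs] at h1
  linarith [hsig j hj, hθ.1]

open Classical in
lemma Bset_diff_Bj_subset (hsig : ∀ j, δs j = true → C * ε < |θs j|) (hl0 : l0 θs = msize δs)
    (j : ℕ) : Bset θs ρ₀ C C₁ ε sbar \ Bj δs θs ρ₀ C C₁ ε j
      ⊆ ⋃ δ ∈ (Finset.univ.filter fun δ : Mdl p =>
          contains δ δs ∧ msize δs + j < msize δ).filter fun δ => msize δ ≤ sbar,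
        {δ} ×ˢ Bdelta θs ρ₀ C C₁ ε δ := by
  rintro ⟨δ, θ⟩ ⟨⟨h1, h2⟩, h3⟩
  have hc := contains_of_mem_Bdelta hsig h2
  have h4 : ¬ msize δ ≤ msize δs + j := fun h => h3 ⟨⟨hl0 ▸ h, hc⟩, h2⟩
  simp only [Set.mem_iUnion]
  refine ⟨δ, ?_, rfl, h2⟩
  simp only [Finset.mem_filter, Finset.mem_univ, true_and]
  exact ⟨⟨hc, not_le.mp h4⟩, h1⟩

lemma Bj_zero_subset (hl0 : l0 θs = msize δs) :
    Bj δs θs ρ₀ C C₁ ε 0 ⊆ {δs} ×ˢ Set.univ := by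
  rintro ⟨δ, θ⟩ ⟨⟨h1, h2⟩, -⟩
  refine ⟨?_, trivial⟩
  rw [add_zero, hl0] at h1
  have h3 : (Finset.univ.filter fun j => δs j = true) = Finset.univ.filter fun j => δ j = true :=
    Finset.eq_of_subset_of_card_le (fun j hj => by
      simp only [Finset.mem_filter, Finset.mem_univ, true_and] at hj ⊢
      exact h2 j hj) h1
  simp only [Set.mem_singleton_iff]
  funext j
  have h4 := congrArg (fun s => j ∈ s) h3
  simp only [Finset.mem_filter, Finset.mem_univ, true_and, eq_iff_iff] at h4
  rw [Bool.eq_iff_iff]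
  exact h4.symm

variable [MeasurableSpace Z]

lemma one_sub_post_Bj_le (hℓ : IsQuasiLik ℓ) (hC : 3 ≤ C) (hρ₀ : 0 < ρ₀) (hρ₁ : 0 < ρ₁)
    (h2 : H2 p q u ρ₁) (hρbar : 0 < ρbar) (hθs : mask δs θs = θs) (hl0 : l0 θs = msize δs)
    (hs : 0 < msize δs) (hsbar : msize δs ≤ sbar) (hsig : StrongSignal δs θs r sbar ρbar C)
    (hε : ε = rate r (l0 θs) sbar ρbar) (hε0 : 0 < ε)
    (hz : z ∈ E2 ℓ q ρ₀ ρ₁ u δs θs ρbar κbar r sbar) (hκ : 0 < κ)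
    (hlow : ∀ δ ∈ Aset δs sbar, ∀ v : SubVec δ, v ≠ 0 → κ ≤ rayleigh ℓ δ z (mle ℓ δ z) v)
    (hdim : 2 * (√(l0 θs : ℝ) + 1) ≤ (C - 1) * ε * √κ)
    (hκp : 4 * ρ₁ ≤ κ * (p : ℝ) ^ u) (j : ℕ) :
    1 - post ℓ q ρ₀ ρ₁ z (Bj δs θs ρ₀ C C₁ ε j)
      ≤ selBound (2 * (C + 1) ^ 3) ρ₁ θs sbar ε (a2 ℓ δs sbar C ε z) κ u j
        + post ℓ q ρ₀ ρ₁ z (Bset θs ρ₀ C C₁ ε sbar)ᶜ := by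
  classical
  have hp : 0 < p := by have := h2.p_ge; omega
  have hp' : (0 : ℝ) < p := by exact_mod_cast hp
  by_cases ha : a2 ℓ δs sbar C ε z = ⊤
  · rw [ha, selBound_top (by positivity) hρ₁ hε0 hκ hp (hs.trans_le hsbar)]
    simp
  have hwd : PostWellDefined ℓ q ρ₀ ρ₁ z := hz.1.1.1
  set B := Bset θs ρ₀ C C₁ ε sbar
  set B' := Bj δs θs ρ₀ C C₁ ε j
  set μ := post ℓ q ρ₀ ρ₁ z with hμ
  set x := √(ρ₁ / κ) * (1 / (p : ℝ) ^ (u / 2)) with hx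
  have hx0 : 0 ≤ x := by positivity
  -- Exactly the condition κ p^u ≥ 4ρ₁.
  have hx2 : x ≤ 1 / 2 := by
    have hpu : 0 < (p : ℝ) ^ (u / 2) := Real.rpow_pos_of_pos hp' _
    have e1 : (p : ℝ) ^ u = ((p : ℝ) ^ (u / 2)) ^ 2 := by
      rw [← Real.rpow_natCast, ← Real.rpow_mul hp'.le]; congr 1; push_cast; ring
    have e2 : √(ρ₁ / κ) ≤ (p : ℝ) ^ (u / 2) / 2 := by
      refine Real.sqrt_le_iff.mpr ⟨by positivity, ?_⟩
      rw [div_le_iff₀ hκ]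
      nlinarith
    calc x ≤ (p : ℝ) ^ (u / 2) / 2 * (1 / (p : ℝ) ^ (u / 2)) := by rw [hx]; gcongr
      _ = 1 / 2 := by field_simp
  -- Subadditivity alone is used, so no measurability of the sets is needed.
  have hcover : μ Set.univ ≤ μ B' + (μ (B \ B') + μ Bᶜ) := by
    refine (measure_mono fun y _ => ?_).trans
      ((measure_union_le B' _).trans (add_le_add_right (measure_union_le _ _) _))
    by_cases h1 : y ∈ B' <;> by_cases h2 : y ∈ B <;> simp [h1, h2]
  have hsub : 1 - μ B' ≤ μ (B \ B') + μ Bᶜ := by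
    rw [tsub_le_iff_left, ← post_univ hwd]
    exact hcover
  refine hsub.trans (add_le_add_left ?_ _)
  set L := laplaceFactor C ρ₁ θs sbar ε (a2 ℓ δs sbar C ε z).toReal κ with hL
  have hL0 : 0 ≤ L := by rw [hL, laplaceFactor]; positivity
  set F := Finset.univ.filter fun δ : Mdl p => contains δ δs ∧ msize δs + j < msize δ with hF
  have hone : (normConst ℓ q ρ₀ ρ₁ z)⁻¹ * sectionMass ℓ q ρ₀ ρ₁ z δs Set.univ ≤ 1 := by
    rw [← post_univ hwd, ← postUnnorm_singleton_prod δs MeasurableSet.univ]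
    exact measure_mono (μ := post ℓ q ρ₀ ρ₁ z) (Set.subset_univ _)
  have hsec : ∀ δ ∈ F.filter fun δ => msize δ ≤ sbar,
      μ ({δ} ×ˢ Bdelta θs ρ₀ C C₁ ε δ)
        ≤ ENNReal.ofReal (2 * L * (x / p) ^ (msize δ - msize δs)) := by
    intro δ hδ
    simp only [hF, Finset.mem_filter, Finset.mem_univ, true_and] at hδ
    have h3 := sectionMass_Bdelta_le (C₁ := C₁) hℓ hC hρ₀ hρ₁ h2 hρbar hθs hl0 hs hsbar hsig hε hε0
      hz hκ hlow hdim ha ⟨hδ.2, hδ.1.1⟩ (m := msize δ - msize δs) (by omega) (by omega)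
    rw [hμ, post, Measure.smul_apply, smul_eq_mul,
      postUnnorm_singleton_prod δ (measurableSet_Bdelta _ _ _ _ _ _)]
    refine (mul_le_mul_right h3 _).trans ?_
    rw [mul_left_comm, mul_left_comm _ 2, ← mul_assoc]
    refine (mul_le_mul_right hone _).trans ?_
    rw [mul_one, mul_comm, mul_assoc 2, ENNReal.ofReal_mul (by norm_num : (0 : ℝ) ≤ 2),
      ENNReal.ofReal_ofNat]
  calc μ (B \ B')
      ≤ ∑ δ ∈ F.filter (fun δ => msize δ ≤ sbar), μ ({δ} ×ˢ Bdelta θs ρ₀ C C₁ ε δ) :=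
        (measure_mono (Bset_diff_Bj_subset (fun j hj => hε ▸ hsig.lt j hj) hl0 j)).trans
          (measure_biUnion_finset_le _ _)
    _ ≤ ∑ δ ∈ F.filter (fun δ => msize δ ≤ sbar),
          ENNReal.ofReal (2 * L * (x / p) ^ (msize δ - msize δs)) := Finset.sum_le_sum hsec
    _ ≤ ∑ δ ∈ F, ENNReal.ofReal (2 * L * (x / p) ^ (msize δ - msize δs)) :=
        Finset.sum_le_sum_of_subset (Finset.filter_subset _ _)
    _ = ENNReal.ofReal (2 * L * ∑ δ ∈ F, (x / p) ^ (msize δ - msize δs)) := by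
        rw [Finset.mul_sum, ENNReal.ofReal_sum_of_nonneg fun δ _ => by positivity]
    -- The constant obtained is 4: 2 from the half-mass bound and 2 from the geometric series.
    _ ≤ ENNReal.ofReal (8 * L * x ^ (j + 1)) := by
        refine ENNReal.ofReal_le_ofReal ?_
        have h4 : ∑ δ ∈ F, (x / p) ^ (msize δ - msize δs) ≤ 2 * x ^ (j + 1) := by
          convert sum_contains_pow_le hp δs j hx0 hx2
        have h5 := mul_le_mul_of_nonneg_left h4 (by positivity : 0 ≤ 2 * L)
        have h6 : 0 ≤ L * x ^ (j + 1) := by positivity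
        linarith
    _ = _ := (selBound_eq ha j).symm

end Posterior

end SpikeSlab

end

theorem theorem3 (C : ℝ) (hC : 3 ≤ C) :
    ∃ C₀ : ℝ, 0 < C₀ ∧
      ∀ (C₁ : ℝ) (_ : 3 ≤ C₁)
        (p : ℕ) (Z : Type*) [MeasurableSpace Z] (ν : Measure Z) [SigmaFinite ν]
        (f : Z → ℝ≥0∞) (ℓ : Vec p → Z → ℝ) (_ : IsQuasiLik ℓ)
        (q u ρ₀ ρ₁ : ℝ) (_ : 0 < ρ₀) (_ : 0 < ρ₁)
        (δs : Mdl p) (θs : Vec p) (ρbar κbar : ℝ)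
        (_ : H1 ν f ℓ q ρ₀ ρ₁ δs θs ρbar κbar) (_ : H2 p q u ρ₁)
        (r : ℝ → ℝ) (_ : IsRate r)
        (sbar : ℕ) (_ : l0 θs ≤ sbar)
        (_ : StrongSignal δs θs r sbar ρbar C)
        (ε : ℝ) (_ : ε = rate r (l0 θs) sbar ρbar)
        (𝓔 : Set Z) (_ : 𝓔 ⊆ E2 ℓ q ρ₀ ρ₁ u δs θs ρbar κbar r sbar)
        (κ : ℝ) (_ : 0 < κ)
        (_ : ∀ z ∈ 𝓔, ∀ δ ∈ Aset δs sbar, ∀ w : SubVec δ, ‖w - mle ℓ δ z‖ ≤ 2 * ε →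
          ∀ v : SubVec δ, v ≠ 0 → κ ≤ rayleigh ℓ δ z w v)
        (_ : ∀ z ∈ 𝓔, ∀ δ ∈ Aset δs sbar, ∀ w v : SubVec δ, v ≠ 0 →
          rayleigh ℓ δ z w v ≤ κbar)
        (_ : 4 * ρ₁ ≤ κ * (p : ℝ) ^ u)
        (_ : 2 * (√(l0 θs : ℝ) + 1) ≤ (C - 1) * ε * √κ),
        (∀ (j : ℕ) (z : Z),
          𝓔.indicator (fun z => 1 - post ℓ q ρ₀ ρ₁ z (Bj δs θs ρ₀ C C₁ ε j)) z
            ≤ selBound C₀ ρ₁ θs sbar ε (a2 ℓ δs sbar C ε z) κ u j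
              + 𝓔.indicator (fun z => post ℓ q ρ₀ ρ₁ z (Bset θs ρ₀ C C₁ ε sbar)ᶜ) z) ∧
        (∀ z : Z,
          𝓔.indicator (fun z => 1 - post ℓ q ρ₀ ρ₁ z ({δs} ×ˢ Set.univ)) z
            ≤ selBound C₀ ρ₁ θs sbar ε (a2 ℓ δs sbar C ε z) κ u 0
              + 𝓔.indicator (fun z => post ℓ q ρ₀ ρ₁ z (Bset θs ρ₀ C C₁ ε sbar)ᶜ) z) := by
  -- Two Taylor remainders on balls of radius (C + 1)ε give 2(C + 1)³, which also dominates the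
  -- coefficient 3C of the slab error.
  refine ⟨2 * (C + 1) ^ 3, by positivity, ?_⟩
  intro C₁ _ p Z _ ν _ f ℓ hℓ q u ρ₀ ρ₁ hρ₀ hρ₁ δs θs ρbar κbar h1 h2 r _ sbar hsbar hsig ε hε 𝓔 h𝓔
    κ hκ hlow _ hκp hdim
  -- Positivity comes from the dimension condition, whose left side is positive.
  have hε0 : 0 < ε := by
    by_contra! h
    have h3 : (C - 1) * ε * √κ ≤ 0 :=
      mul_nonpos_of_nonpos_of_nonneg (mul_nonpos_of_nonneg_of_nonpos (by linarith) h)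
        (Real.sqrt_nonneg _)
    linarith [Real.sqrt_nonneg (l0 θs : ℝ)]
  have hθs : mask δs θs = θs := mem_RpDelta_iff.mp h1.θs_mem
  have hsig' : ∀ j, δs j = true → C * ε < |θs j| := fun j hj => hε ▸ hsig.lt j hj
  have hl0 : l0 θs = msize δs := l0_eq_msize hθs fun j hj h => by
    have h3 := hsig' j hj
    have h4 : 0 < C * ε := by positivity
    rw [h, abs_zero] at h3
    exact h3.not_gt h4
  have hs : 0 < msize δs := by
    rw [← hl0, l0, Finset.card_pos]
    by_contra h
    rw [Finset.not_nonempty_iff_eq_empty, Finset.filter_eq_empty_iff] at h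
    refine h1.θs_ne (PiLp.ext fun j => ?_)
    simpa using h (Finset.mem_univ j)
  have key : ∀ j, ∀ z ∈ 𝓔, 1 - post ℓ q ρ₀ ρ₁ z (Bj δs θs ρ₀ C C₁ ε j)
      ≤ selBound (2 * (C + 1) ^ 3) ρ₁ θs sbar ε (a2 ℓ δs sbar C ε z) κ u j
        + post ℓ q ρ₀ ρ₁ z (Bset θs ρ₀ C C₁ ε sbar)ᶜ := fun j z hz =>
    one_sub_post_Bj_le hℓ hC hρ₀ hρ₁ h2 h1.ρbar_pos hθs hl0 hs (hl0 ▸ hsbar) hsig hε hε0 (h𝓔 hz) hκ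
      (fun δ hδ => hlow z hz δ hδ _ (by simpa using hε0.le)) hdim hκp j
  constructor
  · intro j z
    by_cases hz : z ∈ 𝓔
    · rw [Set.indicator_of_mem hz, Set.indicator_of_mem hz]
      exact key j z hz
    · rw [Set.indicator_of_notMem hz]
      exact zero_le
  · intro z
    by_cases hz : z ∈ 𝓔
    · rw [Set.indicator_of_mem hz, Set.indicator_of_mem hz]
      exact (tsub_le_tsub_left (measure_mono (Bj_zero_subset hl0)) _).trans (key 0 z hz)
    · rw [Set.indicator_of_notMem hz]
      exact zero_le
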